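/- Let $A$ be an architecture of $R$ two-qubit gates on $n$ qubits: a finite directed acyclic graph whose $R$ vertices (gates) each have two incoming and two outgoing edges, together with $n$ open edges on which the qubits enter and $n$ open edges on which they leave. Every edge carries one of the $n$ qubits, and each gate sends the qubit on its first (second) incoming edge to its first (second) outgoing edge. The contraction map $F^A:\mathrm{SU}(4)^{R}\to \mathrm{SU}(2^n)$ sends $x=(U_1,\dots,U_R)$ to the $n$-qubit unitary obtained by placing $U_j$ at the $j$-th gate and contracting all edges between gates. The rank of $F^A$ at $x$ is the rank of its derivative at $x$. For $r\ge 0$ let $E_r\subseteq \mathrm{SU}(4)^R$ be the set of points at which $F^A$ has rank $r$, let $E_{<r}=\bigcup_{r'<r}E_{r'}$, and let $r_{\max}$ be the maximum rank of $F^A$. Let $\mathcal U(A)=F^A(\mathrm{SU}(4)^R)$, and let the accessible dimension $d_A=\dim\mathcal U(A)$ be the dimension of this semialgebraic set, i.e. the greatest dimension of a smooth embedded submanifold of the space of complex $2^n\times 2^n$ matrices that is contained in $\mathcal U(A)$ (equivalently, of a manifold in a decomposition of $\mathcal U(A)$ into finitely many smooth manifolds). Regard $\mathrm{SU}(4)^R$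 as a subset of $\mathbb R^{32R}$ through the real and imaginary parts of the matrix entries, and equip it with the product of the Haar probability measures. Then $E_{<r_{\max}}$ is a real algebraic set (the common zero set in $\mathbb R^{32R}$ of finitely many real polynomials), it is a proper subset of $\mathrm{SU}(4)^R$, it has measure $0$, and it is closed in the Lie-group topology. Equivalently, $E_{r_{\max}}$ is open and has measure $1$. Moreover, $d_A=r_{\max}$. -/

import Mathlib

open Matrix
open scoped ContDiff

/-! ## The gate group -/

/-- `SU(4)`, acting on two qubits: rows and columns are indexed by the computational basis
`Fin 2 × Fin 2` of `ℂ² ⊗ ℂ²`. -/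
abbrev SU4 : Type := ↥(specialUnitaryGroup (Fin 2 × Fin 2) ℂ)

/-- `2ⁿ × 2ⁿ` complex matrices, indexed by the computational basis of `n` qubits. -/
abbrev QubitMatrix (n : ℕ) : Type := Matrix (Fin n → Fin 2) (Fin n → Fin 2) ℂ

/-- `SU(2ⁿ)`, acting on `n` qubits. -/
abbrev SUn (n : ℕ) : Type := ↥(specialUnitaryGroup (Fin n → Fin 2) ℂ)

instance SU4.isTopologicalGroup : IsTopologicalGroup SU4 where
  continuous_mul := by
    refine Continuous.subtype_mk ?_ _
    exact (continuous_subtype_val.comp continuous_fst).mul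
      (continuous_subtype_val.comp continuous_snd)
  continuous_inv := by
    refine Continuous.subtype_mk ?_ _
    exact continuous_subtype_val.star

instance SU4.compactSpace : CompactSpace SU4 := by
  refine isCompact_iff_compactSpace.mp ?_
  have hclosed : IsClosed
      (specialUnitaryGroup (Fin 2 × Fin 2) ℂ : Set (Matrix (Fin 2 × Fin 2) (Fin 2 × Fin 2) ℂ)) := by
    have h : (specialUnitaryGroup (Fin 2 × Fin 2) ℂ :
        Set (Matrix (Fin 2 × Fin 2) (Fin 2 × Fin 2) ℂ)) =
        {A | A * star A = 1} ∩ {A | A.det = 1} := by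
      ext A
      simp [mem_specialUnitaryGroup_iff, mem_unitaryGroup_iff]
    rw [h]
    exact (isClosed_eq (continuous_id.mul continuous_id.star) continuous_const).inter
      (isClosed_eq continuous_id.matrix_det continuous_const)
  have hbox : IsCompact (Set.pi Set.univ fun _ : Fin 2 × Fin 2 =>
      Set.pi Set.univ fun _ : Fin 2 × Fin 2 => Metric.closedBall (0 : ℂ) 1) :=
    isCompact_univ_pi fun _ => isCompact_univ_pi fun _ => isCompact_closedBall _ _
  refine hbox.of_isClosed_subset hclosed fun A hA => ?_
  simp only [Set.mem_pi, Set.mem_univ, true_imp_iff, mem_closedBall_zero_iff]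
  exact fun i j => entry_norm_bound_of_unitary hA.1 i j

noncomputable instance SU4.measurableSpace : MeasurableSpace SU4 := borel SU4

instance SU4.borelSpace : BorelSpace SU4 := ⟨rfl⟩

/-- The Haar probability measure on `SU(4)`. -/
noncomputable def SU4.haar : MeasureTheory.Measure SU4 := MeasureTheory.Measure.haarMeasure ⊤

/-- The distribution of `R` independent Haar-random gates on `SU(4)^R`. -/
noncomputable def gateMeasure (R : ℕ) : MeasureTheory.Measure (Fin R → SU4) :=
  MeasureTheory.Measure.pi fun _ => SU4.haar

/-- The real vector space `su(4)` of traceless Hermitian `4 × 4` matrices. -/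
def su4 : Submodule ℝ (Matrix (Fin 2 × Fin 2) (Fin 2 × Fin 2) ℂ) where
  carrier := {H | H.IsHermitian ∧ H.trace = 0}
  add_mem' := fun h₁ h₂ => ⟨h₁.1.add h₂.1, by simp [trace_add, h₁.2, h₂.2]⟩
  zero_mem' := ⟨isHermitian_zero, trace_zero _ _⟩
  smul_mem' := fun c H h => by
    refine ⟨?_, by simp [trace_smul, h.2]⟩
    have := h.1
    simp only [IsHermitian, conjTranspose_smul, star_trivial] at this ⊢
    rw [this]

/-- `e^{iH} ∈ SU(4)` for `H ∈ su(4)`. -/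
theorem exp_mem_SU4 (H : su4) :
    NormedSpace.exp (Complex.I • (H : Matrix (Fin 2 × Fin 2) (Fin 2 × Fin 2) ℂ)) ∈
      specialUnitaryGroup (Fin 2 × Fin 2) ℂ := by
  obtain ⟨H, hH, htr⟩ := H
  rw [mem_specialUnitaryGroup_iff]
  constructor
  · rw [mem_unitaryGroup_iff, star_eq_conjTranspose, ← exp_conjTranspose, conjTranspose_smul, hH.eq,
      ← exp_add_of_commute]
    · simp
    · simp
  · have hs := hH.spectral_theorem
    set V := hH.eigenvectorUnitary
    have hV : (V : Matrix (Fin 2 × Fin 2) (Fin 2 × Fin 2) ℂ) * star (V : Matrix (Fin 2 × Fin 2) (Fin 2 × Fin 2) ℂ) = 1 := V.2.2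
    have hV' : star (V : Matrix (Fin 2 × Fin 2) (Fin 2 × Fin 2) ℂ) * (V : Matrix (Fin 2 × Fin 2) (Fin 2 × Fin 2) ℂ) = 1 := V.2.1
    let W : (Matrix (Fin 2 × Fin 2) (Fin 2 × Fin 2) ℂ)ˣ := ⟨V, star V, hV, hV'⟩
    have h2 : Complex.I • H = (W : Matrix _ _ ℂ) *
        diagonal (fun i => Complex.I * (hH.eigenvalues i : ℂ)) * ((W⁻¹ : _ˣ) : Matrix _ _ ℂ) := by
      conv_lhs => rw [hs]
      rw [Unitary.conjStarAlgAut_apply]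
      change Complex.I • ((V : Matrix (Fin 2 × Fin 2) (Fin 2 × Fin 2) ℂ) * _ * star (V : Matrix (Fin 2 × Fin 2) (Fin 2 × Fin 2) ℂ)) =
        (V : Matrix (Fin 2 × Fin 2) (Fin 2 × Fin 2) ℂ) * _ * star (V : Matrix (Fin 2 × Fin 2) (Fin 2 × Fin 2) ℂ)
      rw [← Matrix.smul_mul, ← Matrix.mul_smul, ← diagonal_smul]
      rfl
    change det (NormedSpace.exp (Complex.I • H)) = 1
    rw [h2, exp_units_conj, exp_diagonal, det_units_conj, det_diagonal]
    have h3 : ∀ i, NormedSpace.exp (fun i => Complex.I * (hH.eigenvalues i : ℂ)) i =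
        Complex.exp (Complex.I * (hH.eigenvalues i : ℂ)) := by
      intro i
      rw [Pi.coe_exp, Complex.exp_eq_exp_ℂ]
    simp only [h3]
    rw [← Complex.exp_sum, ← Finset.mul_sum]
    have h4 := hH.trace_eq_sum_eigenvalues
    rw [htr] at h4
    simp only [RCLike.ofReal_eq_complex_ofReal] at h4
    rw [← h4]
    simp

/-- The chart `exp_U : su(4) → SU(4)`, `H ↦ e^{iH} U`. -/
noncomputable def expChart (U : SU4) (H : su4) : SU4 := ⟨_, exp_mem_SU4 H⟩ * U

/-! ## Algebraic sets and dimension -/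

/-- The real and imaginary parts of all matrix entries: the embedding of `SU(4)^R` in `ℝ^{32 R}`. -/
def realEntries {R : ℕ} (x : Fin R → SU4) :
    (Fin R × (Fin 2 × Fin 2) × (Fin 2 × Fin 2)) ⊕ (Fin R × (Fin 2 × Fin 2) × (Fin 2 × Fin 2)) → ℝ :=
  Sum.elim
    (fun p => ((x p.1 : Matrix (Fin 2 × Fin 2) (Fin 2 × Fin 2) ℂ) p.2.1 p.2.2).re)
    (fun p => ((x p.1 : Matrix (Fin 2 × Fin 2) (Fin 2 × Fin 2) ℂ) p.2.1 p.2.2).im)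

/-- Algebraic subsets of `ℝ^ι`: the common zeros of finitely many real polynomials. -/
def IsAlgebraicSet {ι : Type*} (V : Set (ι → ℝ)) : Prop :=
  ∃ P : Finset (MvPolynomial ι ℝ), V = {x | ∀ p ∈ P, MvPolynomial.eval x p = 0}

/-- `M` is a smooth embedded submanifold of dimension `d` of the vector space `E`: around each of
its points a smooth diffeomorphism between open subsets of `E` straightens `M` to a linear subspace
of dimension `d`. -/
def IsSmoothSubmanifold {E : Type*} [NormedAddCommGroup E] [NormedSpace ℝ E]
    [FiniteDimensional ℝ E] (d : ℕ) (M : Set E) : Prop :=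
  ∀ p ∈ M, ∃ (Φ : OpenPartialHomeomorph E E) (L : Submodule ℝ E), p ∈ Φ.source ∧
    ContDiffOn ℝ ∞ Φ Φ.source ∧ ContDiffOn ℝ ∞ Φ.symm Φ.target ∧
    Module.finrank ℝ L = d ∧ ∀ q ∈ Φ.source, q ∈ M ↔ Φ q ∈ L

/-- The dimension of a subset `W` of a finite-dimensional real vector space: the greatest dimension
of a nonempty smooth submanifold contained in `W`. If `W` is semialgebraic, this is the greatest
dimension of a manifold in any decomposition of `W` into finitely many smooth manifolds. -/
noncomputable def manifoldDim {E : Type*} [NormedAddCommGroup E] [NormedSpace ℝ E]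
    [FiniteDimensional ℝ E] (W : Set E) : ℕ :=
  sSup {d | ∃ M ⊆ W, M.Nonempty ∧ IsSmoothSubmanifold d M}

/-! ## Architectures and their contraction maps -/

/-- The qubit carried by a leg: `inl i` is the open leg of qubit `i`, and `inr (v, k)` is the
`k`-th leg of gate `v`, which carries the qubit `q v k`. -/
def legQubit {n R : ℕ} (q : Fin R → Fin 2 → Fin n) : Fin n ⊕ Fin R × Fin 2 → Fin n :=
  Sum.elim id fun p => q p.1 p.2

/-- An architecture of `R` two-qubit gates on `n` qubits: a directed acyclic graph whose vertices
are the gates, with two edges entering and two edges leaving every vertex, together with `n` open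
edges where the qubits enter the circuit and `n` open edges where they leave it.

An edge has a tail, which is the input `inl i` of qubit `i` or the `k`-th outgoing leg `inr (v, k)`
of gate `v`, and a head, which is the output `inl i` of qubit `i` or the `k`-th incoming leg
`inr (v, k)` of gate `v`. Every leg lies on exactly one edge, so the edges form a bijection `wiring`
from tails to heads. Edges are qubits: tail and head of an edge carry the same qubit, and a
qubit that enters a gate through its `k`-th incoming leg exits through its `k`-th outgoing leg. -/
structure Architecture (n R : ℕ) where
  /-- The two qubits on which a gate acts. -/
  qubit : Fin R → Fin 2 → Fin n
  /-- The head of the edge with a given tail. -/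
  wiring : Fin n ⊕ Fin R × Fin 2 ≃ Fin n ⊕ Fin R × Fin 2
  /-- An edge carries one and the same qubit at its two ends. -/
  legQubit_wiring : ∀ e, legQubit qubit (wiring e) = legQubit qubit e
  /-- The graph has no directed cycle. -/
  acyclic : ∀ v, ¬ Relation.TransGen
    (fun u w => ∃ k l, wiring (Sum.inr (u, k)) = Sum.inr (w, l)) v v

namespace Architecture

variable {n R : ℕ} (A : Architecture n R)

/-- The tensor network obtained by placing the matrix `U v` at every gate `v` and contracting all
edges between gates: one sums, over all assignments `ℓ` of a bit to every edge (named by its tail)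
with the prescribed values on the open edges, the product of the matrix elements of the gates. -/
noncomputable def contract
    (U : Fin R → Matrix (Fin 2 × Fin 2) (Fin 2 × Fin 2) ℂ) : QubitMatrix n :=
  Matrix.of fun y z => ∑ ℓ : Fin n ⊕ Fin R × Fin 2 → Fin 2,
    if (∀ i, ℓ (Sum.inl i) = z i) ∧ (∀ i, ℓ (A.wiring.symm (Sum.inl i)) = y i) then
      ∏ v, U v (ℓ (Sum.inr (v, 0)), ℓ (Sum.inr (v, 1)))
        (ℓ (A.wiring.symm (Sum.inr (v, 0))), ℓ (A.wiring.symm (Sum.inr (v, 1))))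
    else 0

/-- The gate `U` applied to the qubits `a` and `b`. -/
def gateOn (a b : Fin n) (U : Matrix (Fin 2 × Fin 2) (Fin 2 × Fin 2) ℂ) : QubitMatrix n :=
  Matrix.of fun y w => if ∀ i, i ≠ a → i ≠ b → y i = w i then U (y a, y b) (w a, w b) else 0

/-- Splitting the bits of the qubits `a`, `b` off a bit string. -/
def splitBits {a b : Fin n} (hab : a ≠ b) :
    (Fin n → Fin 2) ≃ (Fin 2 × Fin 2) × ({i : Fin n // i ≠ a ∧ i ≠ b} → Fin 2) where
  toFun y := ((y a, y b), fun i => y i)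
  invFun p i := if ha : i = a then p.1.1 else if hb : i = b then p.1.2 else p.2 ⟨i, ha, hb⟩
  left_inv y := by
    funext i
    by_cases ha : i = a
    · simp [ha]
    · by_cases hb : i = b
      · simp [hb, hab.symm]
      · simp [ha, hb]
  right_inv p := by
    refine Prod.ext (Prod.ext ?_ ?_) ?_
    · simp
    · simp [hab.symm]
    · funext i
      simp [i.2.1, i.2.2]

theorem gateOn_mem {a b : Fin n} (hab : a ≠ b) (U : SU4) :
    gateOn a b U ∈ specialUnitaryGroup (Fin n → Fin 2) ℂ := by
  have h : gateOn a b (U : Matrix _ _ ℂ) = reindex (splitBits hab).symm (splitBits hab).symm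
      (kroneckerMap (fun x y => x * y) (U : Matrix _ _ ℂ)
        (1 : Matrix ({i : Fin n // i ≠ a ∧ i ≠ b} → Fin 2) _ ℂ)) := by
    ext y w
    simp only [gateOn, splitBits, of_apply, reindex_apply, Equiv.symm_symm, submatrix_apply,
      Equiv.coe_fn_mk, kroneckerMap_apply, one_apply, mul_ite, mul_one, mul_zero]
    refine if_congr ?_ rfl rfl
    rw [funext_iff]
    exact ⟨fun h i => h i i.2.1 i.2.2, fun h i ha hb => h ⟨i, ha, hb⟩⟩
  have hU := (mem_specialUnitaryGroup_iff.mp U.2)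
  have hK := kronecker_mem_unitary hU.1
    (one_mem (unitary (Matrix ({i : Fin n // i ≠ a ∧ i ≠ b} → Fin 2) _ ℂ)))
  rw [h, mem_specialUnitaryGroup_iff]
  constructor
  · rw [mem_unitaryGroup_iff, star_eq_conjTranspose, conjTranspose_reindex, reindex_apply,
      reindex_apply, submatrix_mul_equiv]
    have := hK.2
    rw [star_eq_conjTranspose] at this
    rw [this, submatrix_one_equiv]
  · rw [det_reindex_self, det_kronecker, hU.2, det_one, one_pow, one_pow, one_mul]

/-- The tail `e` is a circuit input or belongs to a gate in `S`. -/
def IsPast (S : Finset (Fin R)) (e : Fin n ⊕ Fin R × Fin 2) : Prop :=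
  ∀ v k, e = Sum.inr (v, k) → v ∈ S

/-- `c i` is the edge on which qubit `i` leaves the set `S` of gates. -/
structure IsCut (S : Finset (Fin R)) (c : Fin n → Fin n ⊕ Fin R × Fin 2) : Prop where
  past : ∀ i, IsPast S (c i)
  label : ∀ i, legQubit A.qubit (c i) = i
  cut : ∀ e, IsPast S e → (∃ v k, v ∈ S ∧ A.wiring e = Sum.inr (v, k)) ∨
    c (legQubit A.qubit e) = e

open Classical in
/-- The contraction of the gates in `S` only. -/
noncomputable def partialContract
    (U : Fin R → Matrix (Fin 2 × Fin 2) (Fin 2 × Fin 2) ℂ) (S : Finset (Fin R))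
    (c : Fin n → Fin n ⊕ Fin R × Fin 2) : QubitMatrix n :=
  Matrix.of fun y z => ∑ ℓ : Fin n ⊕ Fin R × Fin 2 → Fin 2,
    if ((∀ i, ℓ (Sum.inl i) = z i) ∧ ∀ v, v ∉ S → ∀ k, ℓ (Sum.inr (v, k)) = 0) ∧
        (∀ i, ℓ (c i) = y i) then
      ∏ v ∈ S, U v (ℓ (Sum.inr (v, 0)), ℓ (Sum.inr (v, 1)))
        (ℓ (A.wiring.symm (Sum.inr (v, 0))), ℓ (A.wiring.symm (Sum.inr (v, 1))))
    else 0

theorem partialContract_empty (U : Fin R → Matrix (Fin 2 × Fin 2) (Fin 2 × Fin 2) ℂ) :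
    A.partialContract U ∅ Sum.inl = 1 := by
  ext y z
  rw [partialContract, of_apply, one_apply]
  by_cases h : y = z
  · subst h
    rw [if_pos rfl, Finset.sum_eq_single (Sum.elim y fun _ => 0)]
    · simp
    · intro ℓ _ hℓ
      rw [if_neg]
      rintro ⟨⟨h1, h2⟩, -⟩
      refine hℓ (funext ?_)
      rintro (i | ⟨v, k⟩)
      · exact h1 i
      · exact h2 v (by simp) k
    · simp
  · rw [if_neg h]
    refine Finset.sum_eq_zero fun ℓ _ => if_neg ?_
    rintro ⟨⟨h1, -⟩, h2⟩
    exact h (funext fun i => (h2 i).symm.trans (h1 i))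

theorem exists_next (S : Finset (Fin R)) (hS : S ≠ Finset.univ) :
    ∃ v, v ∉ S ∧ ∀ k, IsPast S (A.wiring.symm (Sum.inr (v, k))) := by
  let r : Fin R → Fin R → Prop := Relation.TransGen
    (fun u w => ∃ k l, A.wiring (Sum.inr (u, k)) = Sum.inr (w, l))
  have : Std.Irrefl r := ⟨A.acyclic⟩
  have : IsTrans (Fin R) r := ⟨fun _ _ _ => Relation.TransGen.trans⟩
  have hwf : WellFounded r := Finite.wellFounded_of_trans_of_irrefl r
  obtain ⟨v₀, hv₀⟩ : ∃ v, v ∉ S := by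
    by_contra! h
    exact hS (Finset.eq_univ_iff_forall.mpr h)
  obtain ⟨v, hv, hmin⟩ := hwf.has_min {v | v ∉ S} ⟨v₀, hv₀⟩
  refine ⟨v, hv, fun k u l hu => ?_⟩
  by_contra hcon
  refine hmin u hcon (Relation.TransGen.single ⟨l, k, ?_⟩)
  rw [← hu, Equiv.apply_symm_apply]

open Classical in
/-- Moving a cut past the gate `v`. -/
noncomputable def stepCut (c : Fin n → Fin n ⊕ Fin R × Fin 2) (v : Fin R) :
    Fin n → Fin n ⊕ Fin R × Fin 2 := fun i =>
  if i = A.qubit v 0 then Sum.inr (v, 0) else if i = A.qubit v 1 then Sum.inr (v, 1) else c i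

variable {A}

theorem IsCut.tail_eq {S : Finset (Fin R)} {c : Fin n → Fin n ⊕ Fin R × Fin 2} (hc : A.IsCut S c)
    {v : Fin R} (hv : v ∉ S) (hp : ∀ k, IsPast S (A.wiring.symm (Sum.inr (v, k)))) (k : Fin 2) :
    A.wiring.symm (Sum.inr (v, k)) = c (A.qubit v k) := by
  have hl : legQubit A.qubit (A.wiring.symm (Sum.inr (v, k))) = A.qubit v k := by
    rw [← A.legQubit_wiring, Equiv.apply_symm_apply]
    rfl
  rcases hc.cut _ (hp k) with ⟨u, l, hu, h⟩ | h
  · rw [Equiv.apply_symm_apply] at h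
    cases h
    exact absurd hu hv
  · rw [← h, hl]

theorem IsCut.qubit_ne {S : Finset (Fin R)} {c : Fin n → Fin n ⊕ Fin R × Fin 2} (hc : A.IsCut S c)
    {v : Fin R} (hv : v ∉ S) (hp : ∀ k, IsPast S (A.wiring.symm (Sum.inr (v, k)))) :
    A.qubit v 0 ≠ A.qubit v 1 := by
  intro h
  have := (hc.tail_eq hv hp 0).trans ((congrArg c h).trans (hc.tail_eq hv hp 1).symm)
  simp at this

theorem IsCut.step {S : Finset (Fin R)} {c : Fin n → Fin n ⊕ Fin R × Fin 2} (hc : A.IsCut S c)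
    {v : Fin R} (hv : v ∉ S) (hp : ∀ k, IsPast S (A.wiring.symm (Sum.inr (v, k)))) :
    A.IsCut (insert v S) (A.stepCut c v) := by
  have hne := hc.qubit_ne hv hp
  refine ⟨fun i => ?_, fun i => ?_, fun e he => ?_⟩
  · intro u k hu
    unfold stepCut at hu
    split_ifs at hu with h0 h1
    · cases hu
      exact Finset.mem_insert_self _ _
    · cases hu
      exact Finset.mem_insert_self _ _
    · exact Finset.mem_insert_of_mem (hc.past i u k hu)
  · unfold stepCut
    split_ifs with h0 h1
    · exact h0.symm
    · exact h1.symm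
    · exact hc.label i
  · by_cases hev : ∃ k, e = Sum.inr (v, k)
    · obtain ⟨k, rfl⟩ := hev
      right
      change A.stepCut c v (A.qubit v k) = _
      unfold stepCut
      fin_cases k
      · simp
      · simp [hne.symm]
    · have hpe : IsPast S e := fun u k hu =>
        (Finset.mem_insert.mp (he u k hu)).resolve_left fun h => hev ⟨k, h ▸ hu⟩
      rcases hc.cut e hpe with ⟨u, l, hu, h⟩ | h
      · exact Or.inl ⟨u, l, Finset.mem_insert_of_mem hu, h⟩
      · by_cases hq : ∃ k, legQubit A.qubit e = A.qubit v k
        · obtain ⟨k, hk⟩ := hq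
          refine Or.inl ⟨v, k, Finset.mem_insert_self _ _, ?_⟩
          rw [← h, hk, ← hc.tail_eq hv hp k, Equiv.apply_symm_apply]
        · right
          push Not at hq
          unfold stepCut
          rw [if_neg (hq 0), if_neg (hq 1), h]

theorem IsCut.partialContract_step {S : Finset (Fin R)} {c : Fin n → Fin n ⊕ Fin R × Fin 2}
    (hc : A.IsCut S c) {v : Fin R} (hv : v ∉ S)
    (hp : ∀ k, IsPast S (A.wiring.symm (Sum.inr (v, k))))
    (hS : ∀ u ∈ S, ∀ k, IsPast S (A.wiring.symm (Sum.inr (u, k))))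
    (U : Fin R → Matrix (Fin 2 × Fin 2) (Fin 2 × Fin 2) ℂ) :
    A.partialContract U (insert v S) (A.stepCut c v) =
      gateOn (A.qubit v 0) (A.qubit v 1) (U v) * A.partialContract U S c := by
  classical
  have hne := hc.qubit_ne hv hp
  have hpast : ∀ e : Fin n ⊕ Fin R × Fin 2, IsPast S e → ∀ k, e ≠ Sum.inr (v, k) :=
    fun e he k h => hv (he v k h)
  have hcv : ∀ i k, c i ≠ Sum.inr (v, k) := fun i k => hpast _ (hc.past i) k
  have hstep0 : A.stepCut c v (A.qubit v 0) = Sum.inr (v, 0) := by simp [stepCut]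
  have hstep1 : A.stepCut c v (A.qubit v 1) = Sum.inr (v, 1) := by simp [stepCut, hne.symm]
  have hstep : ∀ i, i ≠ A.qubit v 0 → i ≠ A.qubit v 1 → A.stepCut c v i = c i :=
    fun i h0 h1 => by simp [stepCut, h0, h1]
  ext y z
  let P : (Fin n ⊕ Fin R × Fin 2 → Fin 2) → Prop := fun ℓ =>
    (∀ i, ℓ (Sum.inl i) = z i) ∧ ∀ u, u ∉ S → ∀ k, ℓ (Sum.inr (u, k)) = 0
  let W : (Fin n ⊕ Fin R × Fin 2 → Fin 2) → ℂ := fun ℓ =>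
    ∏ u ∈ S, U u (ℓ (Sum.inr (u, 0)), ℓ (Sum.inr (u, 1)))
      (ℓ (A.wiring.symm (Sum.inr (u, 0))), ℓ (A.wiring.symm (Sum.inr (u, 1))))
  have hR : (gateOn (A.qubit v 0) (A.qubit v 1) (U v) * A.partialContract U S c) y z =
      ∑ ℓ : Fin n ⊕ Fin R × Fin 2 → Fin 2,
        if P ℓ ∧ ∀ i, i ≠ A.qubit v 0 → i ≠ A.qubit v 1 → y i = ℓ (c i) then
          U v (y (A.qubit v 0), y (A.qubit v 1)) (ℓ (c (A.qubit v 0)), ℓ (c (A.qubit v 1))) * W ℓ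
        else 0 := by
    rw [mul_apply]
    simp only [partialContract, of_apply, Finset.mul_sum]
    rw [Finset.sum_comm]
    refine Finset.sum_congr rfl fun ℓ _ => ?_
    rw [Finset.sum_eq_single (fun i => ℓ (c i))]
    · by_cases h1 : P ℓ
      · rw [if_pos ⟨h1, fun _ => rfl⟩]
        simp only [gateOn, of_apply, h1, true_and, ite_mul, zero_mul]
        rfl
      · rw [if_neg (fun h => h1 h.1), if_neg (fun h => h1 h.1), mul_zero]
    · intro w _ hw
      rw [if_neg, mul_zero]
      rintro ⟨-, h⟩
      exact hw (funext fun i => (h i).symm)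
    · simp
  rw [hR, partialContract, of_apply, ← Finset.sum_filter, ← Finset.sum_filter]
  let D : (Fin n ⊕ Fin R × Fin 2 → Fin 2) → Fin n ⊕ Fin R × Fin 2 → Fin 2 :=
    fun ℓ e => if ∃ k, e = Sum.inr (v, k) then 0 else ℓ e
  have hD : ∀ ℓ e, (∀ k, e ≠ Sum.inr (v, k)) → D ℓ e = ℓ e :=
    fun ℓ e h => if_neg fun ⟨k, hk⟩ => h k hk
  have hD0 : ∀ ℓ k, D ℓ (Sum.inr (v, k)) = 0 := fun ℓ k => if_pos ⟨k, rfl⟩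
  refine Finset.sum_nbij' D
    (fun ℓ e => if e = Sum.inr (v, 0) then y (A.qubit v 0) else
      if e = Sum.inr (v, 1) then y (A.qubit v 1) else ℓ e) ?_ ?_ ?_ ?_ ?_
  · intro ℓ hℓ
    simp only [Finset.mem_filter, Finset.mem_univ, true_and] at hℓ ⊢
    obtain ⟨⟨h1, h2⟩, h3⟩ := hℓ
    refine ⟨⟨fun i => by rw [hD _ _ (by simp), h1], fun u hu k => ?_⟩, fun i hi0 hi1 => ?_⟩
    · by_cases huv : u = v
      · rw [huv, hD0]
      · rw [hD _ _ (by simp [huv])]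
        exact h2 u (by simp [huv, hu]) k
    · rw [hD _ _ (hcv i), ← h3 i, hstep i hi0 hi1]
  · intro ℓ hℓ
    simp only [Finset.mem_filter, Finset.mem_univ, true_and] at hℓ ⊢
    obtain ⟨⟨h1, h2⟩, h3⟩ := hℓ
    refine ⟨⟨fun i => by simp [h1], fun u hu k => ?_⟩, fun i => ?_⟩
    · have huv : u ≠ v := fun h => hu (h ▸ Finset.mem_insert_self _ _)
      have huS : u ∉ S := fun h => hu (Finset.mem_insert_of_mem h)
      simp [huv, h2 u huS k]
    · by_cases hi0 : i = A.qubit v 0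
      · subst hi0
        simp [hstep0]
      · by_cases hi1 : i = A.qubit v 1
        · subst hi1
          simp [hstep1]
        · rw [hstep i hi0 hi1, if_neg (hcv i 0), if_neg (hcv i 1), h3 i hi0 hi1]
  · intro ℓ hℓ
    simp only [Finset.mem_filter, Finset.mem_univ, true_and] at hℓ
    obtain ⟨⟨h1, h2⟩, h3⟩ := hℓ
    funext e
    dsimp only [D]
    split_ifs with e0 e1 e2
    · rw [e0, ← hstep0, h3]
    · rw [e1, ← hstep1, h3]
    · obtain ⟨k, rfl⟩ := e2
      fin_cases k
      · exact absurd rfl e0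
      · exact absurd rfl e1
    · rfl
  · intro ℓ hℓ
    simp only [Finset.mem_filter, Finset.mem_univ, true_and] at hℓ
    obtain ⟨⟨h1, h2⟩, h3⟩ := hℓ
    funext e
    dsimp only [D]
    split_ifs with e0 e1 e2
    · obtain ⟨k, rfl⟩ := e0
      exact (h2 v hv k).symm
    · exact absurd ⟨0, e1⟩ e0
    · exact absurd ⟨1, e2⟩ e0
    · rfl
  · intro ℓ hℓ
    simp only [Finset.mem_filter, Finset.mem_univ, true_and] at hℓ
    obtain ⟨⟨h1, h2⟩, h3⟩ := hℓ
    rw [Finset.prod_insert hv]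
    congr 1
    · rw [hc.tail_eq hv hp 0, hc.tail_eq hv hp 1, ← h3 (A.qubit v 0), ← h3 (A.qubit v 1), hstep0,
        hstep1, hD _ _ (hcv _), hD _ _ (hcv _)]
    · refine Finset.prod_congr rfl fun u hu => ?_
      have huv : u ≠ v := fun h => hv (h ▸ hu)
      have ht : ∀ k l, A.wiring.symm (Sum.inr (u, k)) ≠ Sum.inr (v, l) :=
        fun k l => hpast _ (hS u hu k) l
      rw [hD _ _ (ht 0), hD _ _ (ht 1), hD _ _ (by simp [huv]), hD _ _ (by simp [huv])]

theorem contract_mem (U : Fin R → SU4) :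
    A.contract (fun v => U v) ∈ specialUnitaryGroup (Fin n → Fin 2) ℂ := by
  have key : ∀ m ≤ R, ∃ (S : Finset (Fin R)) (c : Fin n → Fin n ⊕ Fin R × Fin 2),
      S.card = m ∧ A.IsCut S c ∧
      (∀ u ∈ S, ∀ k, IsPast S (A.wiring.symm (Sum.inr (u, k)))) ∧
      A.partialContract (fun v => U v) S c ∈ specialUnitaryGroup (Fin n → Fin 2) ℂ := by
    intro m
    induction m with
    | zero =>
      refine fun _ => ⟨∅, Sum.inl, rfl, ⟨?_, fun _ => rfl, ?_⟩, by simp, ?_⟩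
      · intro i v k h
        cases h
      · rintro (i | ⟨v, k⟩) he
        · exact Or.inr rfl
        · exact absurd (he v k rfl) (by simp)
      · rw [partialContract_empty]
        exact one_mem _
    | succ m ih =>
      intro hm
      obtain ⟨S, c, hcard, hc, hS, hmem⟩ := ih (by omega)
      have hne : S ≠ Finset.univ := by
        rintro rfl
        simp at hcard
        omega
      obtain ⟨v, hv, hp⟩ := A.exists_next S hne
      refine ⟨insert v S, A.stepCut c v, ?_, hc.step hv hp, ?_, ?_⟩
      · rw [Finset.card_insert_of_notMem hv, hcard]
      · intro u hu k w l h
        rcases Finset.mem_insert.mp hu with rfl | hu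
        · exact Finset.mem_insert_of_mem (hp k w l h)
        · exact Finset.mem_insert_of_mem (hS u hu k w l h)
      · rw [hc.partialContract_step hv hp hS]
        exact mul_mem (gateOn_mem (hc.qubit_ne hv hp) (U v)) hmem
  obtain ⟨S, c, hcard, hc, -, hmem⟩ := key R le_rfl
  obtain rfl : S = Finset.univ := (Finset.card_eq_iff_eq_univ S).mp (by simpa using hcard)
  have hcut : ∀ i, A.wiring.symm (Sum.inl i) = c i := by
    intro i
    rcases hc.cut (A.wiring.symm (Sum.inl i)) (fun v _ _ => Finset.mem_univ v) with
      ⟨v, k, -, h⟩ | h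
    · simp at h
    · rw [← h, ← A.legQubit_wiring, Equiv.apply_symm_apply]
      rfl
  convert hmem using 1
  ext y z
  simp [contract, partialContract, hcut]

variable (A)

/-- The contraction map `F^A : SU(4)^R → SU(2ⁿ)`. -/
noncomputable def contractionMap (x : Fin R → SU4) : SUn n :=
  ⟨A.contract fun v => x v, contract_mem x⟩

/-- The set `𝒰(A)` of implementable unitaries, as a subset of the real vector space of matrices. -/
def implementable : Set (QubitMatrix n) :=
  Set.range fun x : Fin R → SU4 => (A.contractionMap x : QubitMatrix n)

section Rank

open scoped Matrix.Norms.Elementwise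

/-- The rank of `F^A` at `x = (U_v)_v`: the rank of the derivative at `0` of
`(H_v)_v ↦ F^A((e^{i H_v} U_v)_v)`, computed in the chart `expChart` around `x` and in the ambient
vector space of the embedded submanifold `SU(2ⁿ)`. -/
noncomputable def rank (x : Fin R → SU4) : ℕ :=
  Module.finrank ℝ (LinearMap.range (fderiv ℝ (fun H : Fin R → su4 =>
    (A.contractionMap (fun v => expChart (x v) (H v)) : QubitMatrix n)) 0).toLinearMap)

/-- The accessible dimension `d_A`, the dimension of `𝒰(A)`. -/
noncomputable def accessibleDim : ℕ := manifoldDim A.implementable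

end Rank

/-- `E_r`, the points at which `F^A` has rank `r`. -/
def rankLocus (r : ℕ) : Set (Fin R → SU4) := {x | A.rank x = r}

/-- `E_{<r}`, the points at which `F^A` has rank less than `r`. -/
def lowRankLocus (r : ℕ) : Set (Fin R → SU4) := ⋃ r' < r, A.rankLocus r'

/-- The maximum rank `r_max` of `F^A` (the rank takes finitely many values). -/
noncomputable def maxRank : ℕ := sSup (Set.range A.rank)

end Architecture

/-! ### Derivations dual to algebraically independent elements. -/

open MvPolynomial IntermediateField.algebraAdjoinAdjoin in
/-- In characteristic zero, a derivation may take arbitrary values on algebraically independent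
elements of a finitely generated field extension. -/
theorem AlgebraicIndependent.exists_derivation {k K ι : Type*} [Field k] [Field K] [CharZero k]
    [Algebra k K] [Algebra.EssFiniteType k K] {f : ι → K} (hf : AlgebraicIndependent k f)
    (c : ι → K) : ∃ D : Derivation k K K, ∀ i, D (f i) = c i := by
  have : CharZero (IntermediateField.adjoin k (Set.range f)) :=
    charZero_of_injective_algebraMap (algebraMap k _).injective
  have : Algebra.EssFiniteType (IntermediateField.adjoin k (Set.range f)) K := .of_comp k _ K
  -- `K` is formally smooth over `k[f]`: a localization followed by an essentially finite extension
  -- of fields of characteristic zero.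
  have : Algebra.FormallySmooth (Algebra.adjoin k (Set.range f))
      (IntermediateField.adjoin k (Set.range f)) := .of_isLocalization (nonZeroDivisors _)
  have : Algebra.FormallySmooth (Algebra.adjoin k (Set.range f)) K :=
    .comp _ (IntermediateField.adjoin k (Set.range f)) _
  let A := Algebra.adjoin k (Set.range f)
  -- `φ` sends `f i` to `f i + ε c i`, which is possible because `k[f]` is a polynomial ring. Formal
  -- smoothness extends it to a section `h` of `K[ε] → K`, whose `ε`-component is the derivation.
  let φ : A →ₐ[k] TrivSqZeroExt K K := (aeval (fun i => (TrivSqZeroExt.inl (f i) + TrivSqZeroExt.inr (c i) : TrivSqZeroExt K K))).comp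
    hf.aevalEquiv.symm.toAlgHom
  let : Algebra A (TrivSqZeroExt K K) := φ.toRingHom.toAlgebra
  have hφ : ∀ i, φ ⟨f i, Algebra.subset_adjoin ⟨i, rfl⟩⟩ =
      (TrivSqZeroExt.inl (f i) + TrivSqZeroExt.inr (c i) : TrivSqZeroExt K K) := by
    intro i
    have : hf.aevalEquiv.symm ⟨f i, Algebra.subset_adjoin ⟨i, rfl⟩⟩ = X i := by
      rw [AlgEquiv.symm_apply_eq]
      ext
      simp
    simp [φ, this]
  have hfst : ∀ a : A, (TrivSqZeroExt.fst (φ a)) = (a : K) := by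
    intro a
    have h : ((TrivSqZeroExt.fstHom k K K).comp φ).comp hf.aevalEquiv.toAlgHom =
        (A.val).comp hf.aevalEquiv.toAlgHom := by
      ext i
      simp [φ, -DualNumber.inr_eq_smul_eps]
    obtain ⟨p, rfl⟩ := hf.aevalEquiv.surjective a
    exact DFunLike.congr_fun h p
  let π : TrivSqZeroExt K K →ₐ[A] K := { (TrivSqZeroExt.fstHom k K K).toRingHom with commutes' := hfst }
  have hπ : Function.Surjective π := TrivSqZeroExt.fst_surjective
  have hnil : IsNilpotent (RingHom.ker π) := by
    refine ⟨2, ?_⟩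
    refine (pow_two (RingHom.ker π)).trans ?_
    rw [Ideal.zero_eq_bot, eq_bot_iff, Ideal.mul_le]
    intro x hx y hy
    have hx' : TrivSqZeroExt.fst x = 0 := hx
    have hy' : TrivSqZeroExt.fst y = 0 := hy
    rw [Ideal.mem_bot]
    ext <;> simp [hx', hy']
  let h : K →ₐ[A] TrivSqZeroExt K K := Algebra.FormallySmooth.liftOfSurjective (AlgHom.id A K) π hπ hnil
  have hh : ∀ x, TrivSqZeroExt.fst (h x) = x :=
    fun x => Algebra.FormallySmooth.liftOfSurjective_apply (AlgHom.id A K) π hπ hnil x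
  have hA : ∀ a : A, h (a : K) = φ a := fun a => h.commutes a
  have hk : ∀ r : k, h (algebraMap k K r) = TrivSqZeroExt.inl (algebraMap k K r) := fun r => by
    have := hA (algebraMap k A r)
    rw [AlgHom.commutes] at this
    exact this
  refine ⟨Derivation.mk' { toFun := fun x => TrivSqZeroExt.snd (h x), map_add' := ?_, map_smul' := ?_ } ?_, ?_⟩
  · intro x y
    simp
  · intro r x
    rw [Algebra.smul_def, map_mul, hk]
    simp [Algebra.smul_def]
  · intro x y
    simp [hh, mul_comm]
  · intro i
    have := hA ⟨f i, Algebra.subset_adjoin ⟨i, rfl⟩⟩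
    change TrivSqZeroExt.snd (h (f i)) = c i
    rw [this, hφ]
    simp

/-! ### Minors and algebraic sets. -/

/-- The weak half of Cauchy–Binet: the columns of `J * C` are combinations of columns of `J`, so
multilinearity expands the determinant into maximal minors of `J`. -/
theorem Matrix.exists_det_submatrix_ne_zero {K m n : Type*} [CommRing K] [Fintype m]
    [DecidableEq m] [Fintype n] {J : Matrix m n K} {C : Matrix n m K} (h : (J * C).det ≠ 0) :
    ∃ σ : m → n, (J.submatrix id σ).det ≠ 0 := by
  classical
  by_contra! hJ
  refine h ?_
  have h1 : (J * C)ᵀ = fun i => ∑ k, C k i • Jᵀ k := by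
    ext i j
    simp [mul_apply, mul_comm]
  rw [← det_transpose, h1]
  change (detRowAlternating : (m → K) [⋀^m]→ₗ[K] K) (fun i => ∑ k, C k i • Jᵀ k) = 0
  rw [← AlternatingMap.coe_multilinearMap, MultilinearMap.map_sum]
  refine Finset.sum_eq_zero fun σ _ => ?_
  rw [MultilinearMap.map_smul_univ]
  have := hJ σ
  rw [← det_transpose] at this
  refine smul_eq_zero_of_right _ this

/-- Functionals and vectors range over everything instead of over bases, so the same choice can be
kept while `L` varies with the point. -/
theorem LinearMap.le_finrank_range_iff {k V W : Type*} [Field k] [AddCommGroup V] [Module k V]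
    [AddCommGroup W] [Module k W] [FiniteDimensional k V] (L : V →ₗ[k] W) (r : ℕ) :
    r ≤ Module.finrank k L.range ↔
      ∃ (ℓ : Fin r → W →ₗ[k] k) (v : Fin r → V), (Matrix.of fun i j => ℓ i (L (v j))).det ≠ 0 := by
  constructor
  · intro h
    obtain ⟨w, hw⟩ := exists_linearIndependent_of_le_finrank h
    choose v hv using fun i => (w i).2
    have hw' : LinearIndependent k (fun i => (w i : W)) :=
      hw.map' L.range.subtype (Submodule.ker_subtype _)
    obtain ⟨g, hg⟩ := (Finsupp.linearCombination k fun i => (w i : W)).exists_leftInverse_of_injective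
      (LinearMap.ker_eq_bot.mpr hw')
    refine ⟨fun i => (Finsupp.lapply i).comp g, v, ?_⟩
    have : (Matrix.of fun i j => ((Finsupp.lapply i).comp g) (L (v j))) = (1 : Matrix (Fin r) (Fin r) k) := by
      ext i j
      have := DFunLike.congr_fun hg (Finsupp.single j 1)
      simp only [LinearMap.comp_apply, Finsupp.linearCombination_single, one_smul, LinearMap.id_apply] at this
      rw [of_apply, LinearMap.comp_apply, hv, this]
      simp [one_apply, Finsupp.single_apply, eq_comm]
    rw [this, det_one]
    exact one_ne_zero
  · rintro ⟨ℓ, v, h⟩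
    have hli : LinearIndependent k (fun j => (⟨L (v j), v j, rfl⟩ : L.range)) := by
      rw [Fintype.linearIndependent_iff]
      intro c hc
      have hc' : ∑ j, c j • L (v j) = 0 := by
        simpa using congrArg (Submodule.subtype _) hc
      have : (Matrix.of fun i j => ℓ i (L (v j))) *ᵥ c = 0 := by
        ext i
        have := congrArg (ℓ i) hc'
        simpa [mulVec, dotProduct, mul_comm] using this
      intro i
      exact congrFun (Matrix.eq_zero_of_mulVec_eq_zero h this) i
    simpa using hli.fintype_card_le_finrank

/-- Hilbert's basis theorem: the ideal spanned by the equations has finitely many generators. -/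
theorem isAlgebraicSet_of_set {ι : Type*} [Finite ι] (S : Set (MvPolynomial ι ℝ)) :
    IsAlgebraicSet {x | ∀ p ∈ S, MvPolynomial.eval x p = 0} := by
  obtain ⟨P, hP⟩ := IsNoetherian.noetherian (Ideal.span S)
  refine ⟨P, ?_⟩
  have key : ∀ (T : Set (MvPolynomial ι ℝ)) (x : ι → ℝ), (∀ p ∈ T, MvPolynomial.eval x p = 0) ↔
      Ideal.span T ≤ RingHom.ker (MvPolynomial.eval x) := fun T x => by
    rw [Ideal.span_le]
    rfl
  ext x
  exact (key S x).trans (by rw [← hP]; exact (key P x).symm)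

/-! ### Submanifolds from immersions, and their linear projections. -/

section Submanifold

variable {V E : Type*} [NormedAddCommGroup V] [NormedSpace ℝ V] [FiniteDimensional ℝ V]
  [NormedAddCommGroup E] [NormedSpace ℝ E] [FiniteDimensional ℝ E]

/-- With `N` a complement of the range of the derivative, `(v, w) ↦ φ v + w` is a local
diffeomorphism at `0`; the submanifold is the image of the slice `w = 0`. -/
theorem exists_isSmoothSubmanifold_of_injective_fderiv {φ : V → E} (hφ : ContDiff ℝ ∞ φ)
    (hinj : Function.Injective (fderiv ℝ φ 0)) :
    ∃ M ⊆ Set.range φ, M.Nonempty ∧ IsSmoothSubmanifold (Module.finrank ℝ V) M := by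
  obtain ⟨N, hN⟩ := Submodule.exists_isCompl (fderiv ℝ φ 0).range
  let Ψ : V × N → E := fun p => φ p.1 + p.2
  have hΨ : ContDiff ℝ ∞ Ψ := (hφ.comp contDiff_fst).add (N.subtypeL.contDiff.comp contDiff_snd)
  let D : V × N →L[ℝ] E := (fderiv ℝ φ 0).coprod N.subtypeL
  have hD : HasFDerivAt Ψ D 0 := by
    have h1 : HasFDerivAt φ (fderiv ℝ φ 0) ((0 : V × N).1) :=
      (hφ.differentiable (by simp) _).hasFDerivAt
    have h2 := (h1.comp (0 : V × N) hasFDerivAt_fst).add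
      ((N.subtypeL.hasFDerivAt (x := (0 : V × N).2)).comp (0 : V × N) hasFDerivAt_snd)
    refine h2.congr_fderiv ?_
    ext <;> simp [D]
  have hDbij : Function.Bijective D := by
    constructor
    · rw [injective_iff_map_eq_zero]
      rintro ⟨v, w⟩ h
      have h0 : fderiv ℝ φ 0 v + (w : E) = 0 := h
      have h1 : (w : E) ∈ (fderiv ℝ φ 0).range := ⟨-v, by
        rw [ContinuousLinearMap.coe_coe, map_neg]; exact (eq_neg_of_add_eq_zero_right h0).symm⟩
      have h2 : (w : E) = 0 := (Submodule.disjoint_def.mp hN.disjoint) _ h1 w.2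
      rw [h2, add_zero] at h0
      have h3 := hinj (h0.trans (map_zero _).symm)
      exact Prod.ext h3 (Subtype.ext h2)
    · intro y
      obtain ⟨a, ⟨v, rfl⟩, b, hb, rfl⟩ := Submodule.mem_sup.mp (hN.sup_eq_top ▸ Submodule.mem_top : y ∈ _)
      exact ⟨(v, ⟨b, hb⟩), rfl⟩
  let e : (V × N) ≃L[ℝ] E := (LinearEquiv.ofBijective D.toLinearMap hDbij).toContinuousLinearEquiv
  have he : (e : V × N →L[ℝ] E) = D := by ext <;> rfl
  have hD' : HasFDerivAt Ψ (e : V × N →L[ℝ] E) 0 := he ▸ hD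
  let g := hΨ.contDiffAt.toOpenPartialHomeomorph Ψ hD' (by simp)
  have hg0 : (0 : V × N) ∈ g.source := hΨ.contDiffAt.mem_toOpenPartialHomeomorph_source hD' (by simp)
  have hgΨ : ∀ x, g x = Ψ x := fun _ => rfl
  -- At a given point of the target, smoothness of the local inverse requires an invertible
  -- derivative at the preimage. Shrinking to the open set where the derivative is invertible makes
  -- the inverse smooth throughout.
  let S : Set (V × N) := fderiv ℝ Ψ ⁻¹' Set.range ((↑) : ((V × N) ≃L[ℝ] E) → (V × N →L[ℝ] E))
  have hS : IsOpen S := (ContinuousLinearEquiv.isOpen).preimage (hΨ.continuous_fderiv (by simp))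
  have hS0 : (0 : V × N) ∈ S := ⟨e, hD'.fderiv.symm⟩
  let g' := g.restrOpen S hS
  have hg's : g'.source = g.source ∩ S := rfl
  have hsymm : ∀ y ∈ g'.target, ContDiffAt ℝ ∞ g'.symm y := by
    intro y hy
    have hy' := g'.map_target hy
    obtain ⟨e', he'⟩ := hy'.2
    refine g'.contDiffAt_symm (f₀' := e') hy ?_ hΨ.contDiffAt
    rw [he']
    exact (hΨ.differentiable (by simp) _).hasFDerivAt
  -- A straightening has to map `E` to `E`; `e` identifies `V × N` with `E` and takes the slice `w =
  -- 0` to the range of the derivative.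
  let Φ : OpenPartialHomeomorph E E := g'.symm.trans e.toHomeomorph.toOpenPartialHomeomorph
  have hΦ : ∀ x, Φ x = e (g'.symm x) := fun _ => rfl
  have hΦs : Φ.source = g'.target := by simp [Φ]
  let L : Submodule ℝ E := (fderiv ℝ φ 0).range
  have hL : ∀ p : V × N, e p ∈ L ↔ p.2 = 0 := by
    intro p
    have hep : e p = fderiv ℝ φ 0 p.1 + (p.2 : E) := rfl
    rw [hep]
    constructor
    · intro h
      have : (p.2 : E) ∈ L := (Submodule.add_mem_iff_right _ (LinearMap.mem_range_self _ _)).mp h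
      exact Subtype.ext ((Submodule.disjoint_def.mp hN.disjoint) _ this p.2.2)
    · intro h
      rw [h]
      simp [L]
  refine ⟨{q | q ∈ Φ.source ∧ Φ q ∈ L}, ?_, ?_, ?_⟩
  · rintro q ⟨hq, hqL⟩
    rw [hΦs] at hq
    rw [hΦ, hL] at hqL
    refine ⟨(g'.symm q).1, ?_⟩
    have h1 : Ψ (g'.symm q) = q := g'.right_inv hq
    simpa [Ψ, hqL] using h1
  · have h0 : (0 : V × N) ∈ g'.source := ⟨hg0, hS0⟩
    refine ⟨g' 0, hΦs ▸ g'.map_source h0, ?_⟩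
    rw [hΦ, g'.left_inv h0, hL]
    rfl
  · rintro p ⟨hp, hpL⟩
    refine ⟨Φ, L, hp, ?_, ?_, ?_, ?_⟩
    · intro x hx
      exact (e.contDiff.contDiffAt.comp x (hsymm x (hΦs ▸ hx))).contDiffWithinAt
    · exact (hΨ.comp e.symm.contDiff).contDiffOn
    · exact LinearMap.finrank_range_of_inj hinj
    · intro q hq
      exact ⟨fun h => h.2, fun h => ⟨hq, h⟩⟩

/-- On a complement of the kernel the derivative at `0` is injective with the same range, so `φ`
restricts to an immersion there. Constancy of the rank is not needed. -/
theorem exists_isSmoothSubmanifold_subset_range {φ : V → E} (hφ : ContDiff ℝ ∞ φ) :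
    ∃ M ⊆ Set.range φ, M.Nonempty ∧
      IsSmoothSubmanifold (Module.finrank ℝ (fderiv ℝ φ 0).toLinearMap.range) M := by
  obtain ⟨K, hK⟩ := Submodule.exists_isCompl (fderiv ℝ φ 0).toLinearMap.ker
  have hd : HasFDerivAt (φ ∘ K.subtypeL) ((fderiv ℝ φ 0).comp K.subtypeL) 0 := by
    refine HasFDerivAt.comp (0 : K) (g := φ) ?_ K.subtypeL.hasFDerivAt
    rw [map_zero]
    exact (hφ.differentiable (by simp) _).hasFDerivAt
  have hinj : Function.Injective ((fderiv ℝ φ 0).comp K.subtypeL) := by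
    rw [injective_iff_map_eq_zero]
    intro x hx
    exact Subtype.ext ((Submodule.disjoint_def.mp hK.disjoint) _ hx x.2)
  have hrange : ((fderiv ℝ φ 0).toLinearMap ∘ₗ K.subtype).range = (fderiv ℝ φ 0).toLinearMap.range := by
    rw [LinearMap.range_comp, Submodule.range_subtype]
    refine le_antisymm (LinearMap.map_le_range) ?_
    rintro _ ⟨v, rfl⟩
    obtain ⟨a, ha, b, hb, rfl⟩ := Submodule.mem_sup.mp (hK.sup_eq_top ▸ Submodule.mem_top : v ∈ _)
    refine ⟨b, hb, ?_⟩
    rw [map_add, LinearMap.mem_ker.mp ha, zero_add]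
  obtain ⟨M, hM, hne, hsub⟩ := exists_isSmoothSubmanifold_of_injective_fderiv
    (φ := φ ∘ K.subtypeL) (hφ.comp K.subtypeL.contDiff) (by rwa [hd.fderiv])
  refine ⟨M, hM.trans (Set.range_comp_subset_range _ _), hne, ?_⟩
  have hrank : Module.finrank ℝ ((fderiv ℝ φ 0).toLinearMap ∘ₗ K.subtype).range =
      Module.finrank ℝ K := LinearMap.finrank_range_of_inj hinj
  rwa [← hrange, hrank]

/-- A linear map of `E` that is an isomorphism on the tangent space restricts to a submersion near
`p`, hence an open map. Linearity matters: linear coordinates of the contraction map are regular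
functions. -/
theorem IsSmoothSubmanifold.exists_image_mem_nhds {d : ℕ} {M : Set E}
    (hM : IsSmoothSubmanifold d M) (hne : M.Nonempty) :
    ∃ (ℓ : Fin d → E →ₗ[ℝ] ℝ) (y : Fin d → ℝ), (fun q i => ℓ i q) '' M ∈ nhds y := by
  obtain ⟨p, hp⟩ := hne
  obtain ⟨Φ, L, hps, hΦ, hΦ', hL, hmem⟩ := hM p hp
  have hpL : Φ p ∈ L := (hmem p hps).mp hp
  have hpt : Φ p ∈ Φ.target := Φ.map_source hps
  have hcd : ContDiffAt ℝ ∞ Φ.symm (Φ p) := hΦ'.contDiffAt (Φ.open_target.mem_nhds hpt)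
  have hcd' : ContDiffAt ℝ ∞ Φ (Φ.symm (Φ p)) := by
    rw [Φ.left_inv hps]
    exact hΦ.contDiffAt (Φ.open_source.mem_nhds hps)
  set D := fderiv ℝ Φ.symm (Φ p) with hDdef
  have hD : HasStrictFDerivAt Φ.symm D (Φ p) := hcd.hasStrictFDerivAt (by simp)
  have hDinj : Function.Injective D := by
    have h1 : HasFDerivAt (Φ ∘ Φ.symm) ((fderiv ℝ Φ (Φ.symm (Φ p))).comp D) (Φ p) :=
      ((hcd'.differentiableAt (by simp)).hasFDerivAt).comp _ hD.hasFDerivAt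
    have h2 : HasFDerivAt (Φ ∘ Φ.symm) (ContinuousLinearMap.id ℝ E) (Φ p) := by
      refine (hasFDerivAt_id (Φ p)).congr_of_eventuallyEq ?_
      filter_upwards [Φ.open_target.mem_nhds hpt] with x hx
      exact Φ.right_inv hx
    have h3 := h1.unique h2
    intro a b hab
    have := congrArg (fderiv ℝ Φ (Φ.symm (Φ p))) hab
    have h4 := fun a => DFunLike.congr_fun h3 a
    simp only [ContinuousLinearMap.comp_apply, ContinuousLinearMap.id_apply] at h4
    rwa [h4, h4] at this
  let DL : L →ₗ[ℝ] E := D.toLinearMap.comp L.subtype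
  have hDL : DL.ker = ⊥ := LinearMap.ker_eq_bot.mpr (hDinj.comp Subtype.val_injective)
  obtain ⟨π, hπ⟩ := DL.exists_leftInverse_of_injective hDL
  let b : L ≃ₗ[ℝ] (Fin d → ℝ) := LinearEquiv.ofFinrankEq _ _ (by simp [hL])
  let π' : E →L[ℝ] (Fin d → ℝ) := (b.toLinearMap.comp π).toContinuousLinearMap
  let l₀ : L := ⟨Φ p, hpL⟩
  have hstrict : HasStrictFDerivAt (fun l : L => π' (Φ.symm l)) (π'.comp (D.comp L.subtypeL)) l₀ :=
    π'.hasStrictFDerivAt.comp l₀ (HasStrictFDerivAt.comp l₀ hD L.subtypeL.hasStrictFDerivAt)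
  have hsurj : (π'.comp (D.comp L.subtypeL)).range = ⊤ := by
    rw [LinearMap.range_eq_top]
    intro y
    refine ⟨b.symm y, ?_⟩
    have : π (DL (b.symm y)) = b.symm y := DFunLike.congr_fun hπ _
    change b (π (DL (b.symm y))) = y
    rw [this, LinearEquiv.apply_symm_apply]
  have hmap := hstrict.map_nhds_eq_of_surj hsurj
  refine ⟨fun i => (LinearMap.proj i).comp π'.toLinearMap, π' (Φ.symm l₀), ?_⟩
  rw [← hmap, Filter.mem_map]
  have hopen : (fun l : L => (l : E)) ⁻¹' Φ.target ∈ nhds l₀ :=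
    (Φ.open_target.preimage continuous_subtype_val).mem_nhds hpt
  filter_upwards [hopen] with l hl
  refine ⟨Φ.symm l, (hmem _ (Φ.map_target hl)).mpr ?_, rfl⟩
  rw [Φ.right_inv hl]
  exact l.2

end Submanifold

/-! ### The matrix exponential: regularity and surjectivity. -/

section MatrixExp

variable {m : Type*} [Fintype m] [DecidableEq m]

section Banach

variable {V 𝔸 : Type*} [NormedAddCommGroup V] [NormedSpace ℝ V] [FiniteDimensional ℝ V]
  [NormedRing 𝔸] [NormedAlgebra ℂ 𝔸] [CompleteSpace 𝔸]

theorem contDiff_clm_exp_comp (A : V →ₗ[ℝ] 𝔸) (ℓ : 𝔸 →L[ℂ] ℂ) :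
    ContDiff ℝ ω (fun v => ℓ (NormedSpace.exp (A v))) := by
  have h1 : ContDiff ℝ ω (NormedSpace.exp : 𝔸 → 𝔸) :=
    contDiff_omega_iff_analyticOnNhd.mpr fun x _ => NormedSpace.exp_analytic (𝕂 := ℝ) x
  exact (ℓ.restrictScalars ℝ).contDiff.comp (h1.comp A.toContinuousLinearMap.contDiff)

theorem hasFDerivAt_clm_exp_comp (A : V →ₗ[ℝ] 𝔸) (ℓ : 𝔸 →L[ℂ] ℂ) :
    HasFDerivAt (fun v => ℓ (NormedSpace.exp (A v)))
      ((ℓ.restrictScalars ℝ).comp A.toContinuousLinearMap) 0 := by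
  have h1 : HasFDerivAt (NormedSpace.exp : 𝔸 → 𝔸) (1 : 𝔸 →L[ℝ] 𝔸) (A.toContinuousLinearMap 0) := by
    rw [(A.toContinuousLinearMap).map_zero]
    exact hasFDerivAt_exp_zero (𝕂 := ℝ)
  exact (ℓ.restrictScalars ℝ).hasFDerivAt.comp 0 (h1.comp 0 A.toContinuousLinearMap.hasFDerivAt)

end Banach

variable {V : Type*} [NormedAddCommGroup V] [NormedSpace ℝ V] [FiniteDimensional ℝ V]

/-- Stated for a single entry, so that the submultiplicative norm of the proof stays out of the
statement; the elementwise norm used elsewhere is not submultiplicative. -/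
theorem Matrix.contDiff_exp_comp_apply (A : V →ₗ[ℝ] Matrix m m ℂ) (a b : m) :
    ContDiff ℝ ω (fun v => NormedSpace.exp (A v) a b) := by
  let : NormedRing (Matrix m m ℂ) := Matrix.linftyOpNormedRing
  let : NormedAlgebra ℂ (Matrix m m ℂ) := Matrix.linftyOpNormedAlgebra
  exact contDiff_clm_exp_comp A (Matrix.entryLinearMap ℂ ℂ a b).toContinuousLinearMap

theorem Matrix.hasFDerivAt_exp_comp_apply (A : V →ₗ[ℝ] Matrix m m ℂ) (a b : m) :
    HasFDerivAt (fun v => NormedSpace.exp (A v) a b)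
      ((Matrix.entryLinearMap ℝ ℂ a b).comp A).toContinuousLinearMap 0 := by
  let : NormedRing (Matrix m m ℂ) := Matrix.linftyOpNormedRing
  let : NormedAlgebra ℂ (Matrix m m ℂ) := Matrix.linftyOpNormedAlgebra
  exact (hasFDerivAt_clm_exp_comp A
    (Matrix.entryLinearMap ℂ ℂ a b).toContinuousLinearMap).congr_fderiv (by ext; rfl)

-- `H` is the argument of `U` in the functional calculus. The branch cut does no harm, since the
-- spectrum is finite and every function on it is continuous.
open scoped Matrix.Norms.L2Operator in
theorem Matrix.exists_isHermitian_exp_eq {U : Matrix m m ℂ} (hU : U ∈ unitaryGroup m ℂ) :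
    ∃ H : Matrix m m ℂ, H.IsHermitian ∧ NormedSpace.exp (Complex.I • H) = U := by
  have hn : IsStarNormal U := ⟨by
    rw [commute_iff_eq, mem_unitaryGroup_iff.mp hU, mem_unitaryGroup_iff'.mp hU]⟩
  have hc : ∀ f : ℂ → ℂ, ContinuousOn f (spectrum ℂ U) := fun f => U.finite_spectrum.continuousOn f
  refine ⟨cfc (fun z => (Complex.arg z : ℂ)) U, IsSelfAdjoint.cfc_arg U, ?_⟩
  rw [← CFC.exp_eq_normedSpace_exp (𝕜 := ℂ), ← cfc_comp_smul .., 
    ← cfc_comp' (fun z => NormedSpace.exp (Complex.I • z)) (fun z => (Complex.arg z : ℂ)) U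
      ((U.finite_spectrum.image _).continuousOn _) (hc _)]
  conv_rhs => rw [← cfc_id' ℂ U]
  refine cfc_congr fun y hy => ?_
  have hy₁ : ‖y‖ = 1 := spectrum.norm_eq_one_of_unitary hU hy
  have hy0 : y ≠ 0 := by
    rintro rfl
    simp at hy₁
  have : Complex.I * y.arg = Complex.log y :=
    Complex.ext (by simp [Complex.log_re, hy₁]) (by simp [Complex.log_im])
  simpa [← Complex.exp_eq_exp_ℂ, this] using Complex.exp_log hy0

theorem Matrix.exp_unitary_conj_diagonal (W : unitaryGroup m ℂ) (μ : m → ℝ) :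
    NormedSpace.exp (Complex.I • ((W : Matrix m m ℂ) * diagonal (fun i => (μ i : ℂ)) * star (W : Matrix m m ℂ))) =
      (W : Matrix m m ℂ) * diagonal (fun i => Complex.exp (Complex.I * μ i)) * star (W : Matrix m m ℂ) := by
  let W' : (Matrix m m ℂ)ˣ := ⟨W, star W, W.2.2, W.2.1⟩
  have h := exp_units_conj W' (Complex.I • diagonal (fun i => (μ i : ℂ)))
  have h1 : NormedSpace.exp (Complex.I • diagonal (fun i => (μ i : ℂ))) =
      diagonal (fun i => Complex.exp (Complex.I * μ i)) := by
    rw [← diagonal_smul, exp_diagonal]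
    congr 1
    ext i
    rw [Pi.coe_exp, Complex.exp_eq_exp_ℂ]
    rfl
  rw [h1] at h
  rw [← Matrix.smul_mul, ← Matrix.mul_smul]
  exact h

/-- The trace `s` of any Hermitian logarithm satisfies `e^{is} = det U = 1`. Subtracting `s` from
one eigenvalue therefore kills the trace and preserves the exponential. -/
theorem Matrix.exists_isHermitian_trace_eq_zero_exp_eq [Nonempty m] {U : Matrix m m ℂ}
    (hU : U ∈ specialUnitaryGroup m ℂ) :
    ∃ H : Matrix m m ℂ, H.IsHermitian ∧ H.trace = 0 ∧ NormedSpace.exp (Complex.I • H) = U := by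
  obtain ⟨hU, hdet⟩ := mem_specialUnitaryGroup_iff.mp hU
  obtain ⟨H, hH, rfl⟩ := exists_isHermitian_exp_eq hU
  set W := hH.eigenvectorUnitary
  have hHW : H = (W : Matrix m m ℂ) * diagonal (fun i => (hH.eigenvalues i : ℂ)) * star (W : Matrix m m ℂ) := by
    conv_lhs => rw [hH.spectral_theorem]
    rw [Unitary.conjStarAlgAut_apply]
    rfl
  have hWW : star (W : Matrix m m ℂ) * (W : Matrix m m ℂ) = 1 := W.2.1
  have hWdet : (W : Matrix m m ℂ).det * (star (W : Matrix m m ℂ)).det = 1 := by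
    rw [← det_mul, W.2.2, det_one]
  set s : ℝ := ∑ i, hH.eigenvalues i
  have hs : Complex.exp (Complex.I * s) = 1 := by
    rw [hHW, exp_unitary_conj_diagonal, det_mul, det_mul, det_diagonal, mul_right_comm, hWdet,
      one_mul, ← Complex.exp_sum, ← Finset.mul_sum, ← Complex.ofReal_sum] at hdet
    exact hdet
  let i₀ : m := Classical.arbitrary m
  let μ : m → ℝ := fun i => hH.eigenvalues i - if i = i₀ then s else 0
  refine ⟨(W : Matrix m m ℂ) * diagonal (fun i => (μ i : ℂ)) * star (W : Matrix m m ℂ), ?_, ?_, ?_⟩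
  · rw [star_eq_conjTranspose]
    refine isHermitian_mul_mul_conjTranspose _ ?_
    exact isHermitian_diagonal_of_self_adjoint _ (by ext i; simp)
  · rw [trace_mul_cycle, hWW, one_mul, trace_diagonal, ← Complex.ofReal_sum]
    simp [μ, s]
  · rw [exp_unitary_conj_diagonal]
    conv_rhs => rw [hHW, exp_unitary_conj_diagonal]
    congr 3
    ext i
    simp only [μ]
    split_ifs
    · rw [Complex.ofReal_sub, mul_sub, Complex.exp_sub, hs, div_one]
    · simp

end MatrixExp

/-! ### Regular functions on the gate group and their derivatives. -/

section RegularFunctions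

open scoped Matrix.Norms.Elementwise

variable {R : ℕ}

/-- The translate of the gates `x` by the one-parameter elements `e^{i H_v}`. -/
noncomputable def expShift (H : Fin R → su4) (x : Fin R → SU4) : Fin R → SU4 :=
  fun v => expChart (x v) (H v)

/-- A matrix entry of a gate, as a function of the gates. -/
def gateEntry (v : Fin R) (a b : Fin 2 × Fin 2) : (Fin R → SU4) → ℂ :=
  fun x => (x v : Matrix (Fin 2 × Fin 2) (Fin 2 × Fin 2) ℂ) a b

/-- The regular functions on `SU(4)^R`: the complex polynomials in the matrix entries. -/
noncomputable def regularFunctions (R : ℕ) : Subalgebra ℂ ((Fin R → SU4) → ℂ) :=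
  Algebra.adjoin ℂ (Set.range fun p : Fin R × (Fin 2 × Fin 2) × (Fin 2 × Fin 2) =>
    gateEntry p.1 p.2.1 p.2.2)

theorem gateEntry_mem (v : Fin R) (a b : Fin 2 × Fin 2) : gateEntry v a b ∈ regularFunctions R :=
  Algebra.subset_adjoin ⟨(v, a, b), rfl⟩

@[elab_as_elim]
theorem regularFunctions_induction {P : (f : (Fin R → SU4) → ℂ) → f ∈ regularFunctions R → Prop}
    (entry : ∀ v a b, P (gateEntry v a b) (gateEntry_mem v a b))
    (const : ∀ c : ℂ, P (fun _ => c) ((regularFunctions R).algebraMap_mem c))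
    (add : ∀ f g hf hg, P f hf → P g hg → P (f + g) (add_mem hf hg))
    (mul : ∀ f g hf hg, P f hf → P g hg → P (f * g) (mul_mem hf hg))
    {f : (Fin R → SU4) → ℂ} (hf : f ∈ regularFunctions R) : P f hf := by
  induction hf using Algebra.adjoin_induction with
  | mem f hf => obtain ⟨p, rfl⟩ := hf; exact entry _ _ _
  | algebraMap c => exact const c
  | add f g hf hg h₁ h₂ => exact add f g hf hg h₁ h₂
  | mul f g hf hg h₁ h₂ => exact mul f g hf hg h₁ h₂

theorem const_mem_regularFunctions (c : ℂ) : (fun _ : Fin R → SU4 => c) ∈ regularFunctions R :=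
  (regularFunctions R).algebraMap_mem c

theorem continuous_of_mem_regularFunctions {f : (Fin R → SU4) → ℂ} (hf : f ∈ regularFunctions R) :
    Continuous f := by
  induction hf using regularFunctions_induction with
  | entry v a b =>
    exact (continuous_subtype_val.comp (continuous_apply v)).matrix_elem a b
  | const c => exact continuous_const
  | add f g _ _ hf hg => exact hf.add hg
  | mul f g _ _ hf hg => exact hf.mul hg

theorem det_mem_regularFunctions {k : Type*} [Fintype k] [DecidableEq k]
    {g : k → k → (Fin R → SU4) → ℂ} (hg : ∀ i j, g i j ∈ regularFunctions R) :
    (fun x => (Matrix.of fun i j => g i j x).det) ∈ regularFunctions R := by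
  have : (fun x => (Matrix.of fun i j => g i j x).det) =
      ∑ σ : Equiv.Perm k, (fun _ => ((Equiv.Perm.sign σ : ℤ) : ℂ)) * ∏ i, g (σ i) i := by
    ext x
    simp [det_apply', Finset.sum_apply, Finset.prod_apply]
  rw [this]
  exact sum_mem fun σ _ => mul_mem (const_mem_regularFunctions _) (prod_mem fun i _ => hg _ _)

theorem Matrix.star_eq_adjugate_of_mem {m : Type*} [Fintype m] [DecidableEq m] {U : Matrix m m ℂ}
    (hU : U ∈ specialUnitaryGroup m ℂ) : star U = U.adjugate := by
  obtain ⟨hU, hdet⟩ := mem_specialUnitaryGroup_iff.mp hU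
  calc star U = star U * (U * U.adjugate) := by rw [mul_adjugate, hdet, one_smul, mul_one]
    _ = U.adjugate := by rw [← mul_assoc, mem_unitaryGroup_iff'.mp hU, one_mul]

/-- The conjugate of an entry of `U` is an entry of the inverse, hence a cofactor because `det U =
1`. This brings real and imaginary parts into the ring. -/
theorem star_mem_regularFunctions {f : (Fin R → SU4) → ℂ} (hf : f ∈ regularFunctions R) :
    star f ∈ regularFunctions R := by
  induction hf using regularFunctions_induction with
  | entry v a b =>
    -- The adjugate entry `(b, a)`: the determinant of the gate with row `a` replaced by the `b`-th
    -- unit vector.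
    have : star (gateEntry v a b) = fun x => (Matrix.of fun i j =>
        (if i = a then fun _ => (Pi.single b 1 : Fin 2 × Fin 2 → ℂ) j else gateEntry v i j : (Fin R → SU4) → ℂ) x).det := by
      ext x
      have h := congrFun (congrFun (star_eq_adjugate_of_mem (x v).2) b) a
      rw [adjugate_apply, star_apply] at h
      refine h.trans (congrArg det ?_)
      ext i j
      rw [updateRow_apply, of_apply]
      split_ifs <;> rfl
    rw [this]
    refine det_mem_regularFunctions fun i j => ?_
    split_ifs
    · exact const_mem_regularFunctions _
    · exact gateEntry_mem v i j
  | const c => exact const_mem_regularFunctions (star c)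
  | add f g _ _ hf hg => rw [star_add]; exact add_mem hf hg
  | mul f g _ _ hf hg => rw [star_mul']; exact mul_mem hf hg

theorem exists_mvPolynomial_of_mem_regularFunctions {f : (Fin R → SU4) → ℂ}
    (hf : f ∈ regularFunctions R) : ∃ p q, ∀ x, MvPolynomial.eval (realEntries x) p = (f x).re ∧
      MvPolynomial.eval (realEntries x) q = (f x).im := by
  induction hf using regularFunctions_induction with
  | entry v a b =>
    exact ⟨.X (Sum.inl (v, a, b)), .X (Sum.inr (v, a, b)), fun x => by
      simp [realEntries, gateEntry]⟩
  | const c => exact ⟨.C c.re, .C c.im, fun x => by simp⟩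
  | add f g _ _ hf hg =>
    obtain ⟨p, q, h⟩ := hf
    obtain ⟨p', q', h'⟩ := hg
    exact ⟨p + p', q + q', fun x => by simp [h, h']⟩
  | mul f g _ _ hf hg =>
    obtain ⟨p, q, h⟩ := hf
    obtain ⟨p', q', h'⟩ := hg
    exact ⟨p * p' - q * q', p * q' + q * p', fun x => by simp [h, h']⟩

/-- Multiplication by `i`, as a linear map from `su(4)` to matrices. -/
noncomputable def su4.mulI : su4 →ₗ[ℝ] Matrix (Fin 2 × Fin 2) (Fin 2 × Fin 2) ℂ where
  toFun H := Complex.I • (H : Matrix (Fin 2 × Fin 2) (Fin 2 × Fin 2) ℂ)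
  map_add' _ _ := smul_add _ _ _
  map_smul' _ _ := smul_comm _ _ _

/-- The `v`-th component of a tangent vector, multiplied by `i`. -/
noncomputable def su4.mulIProj (v : Fin R) :
    (Fin R → su4) →ₗ[ℝ] Matrix (Fin 2 × Fin 2) (Fin 2 × Fin 2) ℂ :=
  su4.mulI ∘ₗ LinearMap.proj v

theorem gateEntry_expShift (v : Fin R) (a b : Fin 2 × Fin 2) (H : Fin R → su4) (x : Fin R → SU4) :
    gateEntry v a b (expShift H x) =
      ∑ c, NormedSpace.exp (su4.mulIProj v H) a c * gateEntry v c b x := rfl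

theorem contDiff_expShift {f : (Fin R → SU4) → ℂ} (hf : f ∈ regularFunctions R)
    (x : Fin R → SU4) : ContDiff ℝ ω (fun H => f (expShift H x)) := by
  induction hf using regularFunctions_induction with
  | entry v a b =>
    simp only [gateEntry_expShift]
    exact ContDiff.sum fun c _ =>
      (Matrix.contDiff_exp_comp_apply (su4.mulIProj v) a c).mul contDiff_const
  | const c => exact contDiff_const
  | add f g _ _ hf hg => exact hf.add hg
  | mul f g _ _ hf hg => exact hf.mul hg

theorem differentiableAt_expShift {f : (Fin R → SU4) → ℂ} (hf : f ∈ regularFunctions R)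
    (x : Fin R → SU4) (H : Fin R → su4) : DifferentiableAt ℝ (fun H => f (expShift H x)) H :=
  (contDiff_expShift hf x).differentiable (by simp) H

theorem expShift_zero (x : Fin R → SU4) : expShift 0 x = x := by
  funext v
  refine Subtype.ext ?_
  change NormedSpace.exp (Complex.I • (0 : Matrix (Fin 2 × Fin 2) (Fin 2 × Fin 2) ℂ)) * (x v).1 = (x v).1
  rw [smul_zero, NormedSpace.exp_zero, one_mul]

/-- The derivative of `f` at `x` in the direction of `i H x`. -/
noncomputable def lieDeriv (H : Fin R → su4) (f : (Fin R → SU4) → ℂ) : (Fin R → SU4) → ℂ :=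
  fun x => fderiv ℝ (fun K => f (expShift K x)) 0 H

theorem lieDeriv_gateEntry (H : Fin R → su4) (v : Fin R) (a b : Fin 2 × Fin 2) :
    lieDeriv H (gateEntry v a b) = fun x => ∑ c, (Complex.I * (H v).1 a c) * gateEntry v c b x := by
  ext x
  have h := HasFDerivAt.fun_sum fun c (_ : c ∈ Finset.univ) =>
    (Matrix.hasFDerivAt_exp_comp_apply (su4.mulIProj v) a c).mul_const
      (gateEntry v c b x)
  refine (DFunLike.congr_fun h.fderiv H).trans ?_
  simp [su4.mulIProj, su4.mulI, mul_comm]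

theorem lieDeriv_const (H : Fin R → su4) (c : ℂ) : lieDeriv H (fun _ => c) = 0 := by
  ext x
  simp [lieDeriv]

theorem lieDeriv_add (H : Fin R → su4) {f g : (Fin R → SU4) → ℂ} (hf : f ∈ regularFunctions R)
    (hg : g ∈ regularFunctions R) : lieDeriv H (f + g) = lieDeriv H f + lieDeriv H g := by
  ext x
  have := fderiv_fun_add (differentiableAt_expShift hf x 0) (differentiableAt_expShift hg x 0)
  exact DFunLike.congr_fun this H

theorem lieDeriv_mul (H : Fin R → su4) {f g : (Fin R → SU4) → ℂ} (hf : f ∈ regularFunctions R)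
    (hg : g ∈ regularFunctions R) : lieDeriv H (f * g) = f * lieDeriv H g + g * lieDeriv H f := by
  ext x
  have := fderiv_fun_mul (differentiableAt_expShift hf x 0) (differentiableAt_expShift hg x 0)
  have := DFunLike.congr_fun this H
  simp only [expShift_zero] at this
  exact this

/-- The derivative of a gate `U` is `iHU`, linear in the entries of `U` with constant coefficients;
the Leibniz rule does the rest. -/
theorem lieDeriv_mem (H : Fin R → su4) {f : (Fin R → SU4) → ℂ} (hf : f ∈ regularFunctions R) :
    lieDeriv H f ∈ regularFunctions R := by
  induction hf using regularFunctions_induction with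
  | entry v a b =>
    have : lieDeriv H (gateEntry v a b) =
        ∑ c, (fun _ => Complex.I * (H v).1 a c) * gateEntry v c b := by
      rw [lieDeriv_gateEntry]
      ext x
      simp [Finset.sum_apply]
    rw [this]
    exact sum_mem fun c _ => mul_mem (const_mem_regularFunctions _) (gateEntry_mem v c b)
  | const c => rw [lieDeriv_const]; exact zero_mem _
  | add f g hf' hg' hf hg => rw [lieDeriv_add H hf' hg']; exact add_mem hf hg
  | mul f g hf' hg' hf hg =>
    rw [lieDeriv_mul H hf' hg']
    exact add_mem (mul_mem hf' hg) (mul_mem hg' hf)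

/-- The derivative in the direction of `i H x`, as a derivation of the ring of regular functions. -/
noncomputable def lieDerivation (H : Fin R → su4) :
    Derivation ℂ (regularFunctions R) (regularFunctions R) :=
  Derivation.mk'
    { toFun := fun f => ⟨lieDeriv H f, lieDeriv_mem H f.2⟩
      map_add' := fun f g => Subtype.ext (lieDeriv_add H f.2 g.2)
      map_smul' := fun c f => Subtype.ext <| by
        have h : (c • f.1 : (Fin R → SU4) → ℂ) = (fun _ => c) * f.1 := rfl
        change lieDeriv H (c • f.1) = c • lieDeriv H f.1
        rw [h, lieDeriv_mul H (const_mem_regularFunctions c) f.2, lieDeriv_const, mul_zero, add_zero]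
        rfl }
    fun f g => Subtype.ext (lieDeriv_mul H f.2 g.2)

theorem expShift_add_smul (s t : ℝ) (H : Fin R → su4) (x : Fin R → SU4) :
    expShift ((s + t) • H) x = expShift (s • H) (expShift (t • H) x) := by
  funext v
  refine Subtype.ext ?_
  change NormedSpace.exp (su4.mulI ((s + t) • H v)) * (x v : Matrix _ _ ℂ) =
    NormedSpace.exp (su4.mulI (s • H v)) * (NormedSpace.exp (su4.mulI (t • H v)) * (x v : Matrix _ _ ℂ))
  rw [← mul_assoc, add_smul, map_add, Matrix.exp_add_of_commute]
  rw [map_smul, map_smul]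
  exact ((Commute.refl _).smul_left _).smul_right _

theorem exists_expShift_eq (x y : Fin R → SU4) : ∃ H, expShift H x = y := by
  have h : ∀ v, ∃ H : su4, expChart (x v) H = y v := fun v => by
    obtain ⟨H, hH, htr, hexp⟩ := exists_isHermitian_trace_eq_zero_exp_eq (y v * (x v)⁻¹).2
    refine ⟨⟨H, hH, htr⟩, ?_⟩
    have : (⟨_, exp_mem_SU4 ⟨H, hH, htr⟩⟩ : SU4) = y v * (x v)⁻¹ := Subtype.ext hexp
    rw [expChart, this, inv_mul_cancel_right]
  choose H hH using h
  exact ⟨H, funext hH⟩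

/-- The shift is a left translation, so it preserves the product of the Haar measures. -/
theorem expShift_eq_mul (H : Fin R → su4) (x : Fin R → SU4) : expShift H x = expShift H 1 * x := by
  funext v
  simp [expShift, expChart]

end RegularFunctions

/-! ### Zero sets of regular functions have measure zero. -/

section ZeroSets

open MeasureTheory
open scoped Matrix.Norms.Elementwise

variable {R : ℕ}

instance Matrix.secondCountableTopology_complex {m n : Type*} [Countable m] [Countable n] :
    SecondCountableTopology (Matrix m n ℂ) :=
  inferInstanceAs (SecondCountableTopology (m → n → ℂ))

instance SU4.secondCountableTopology : SecondCountableTopology SU4 :=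
  TopologicalSpace.Subtype.secondCountableTopology _

instance su4.secondCountableTopology : SecondCountableTopology su4 :=
  TopologicalSpace.Subtype.secondCountableTopology _

instance SU4.isHaarMeasure_haar : SU4.haar.IsHaarMeasure :=
  Measure.isHaarMeasure_haarMeasure _

instance SU4.isProbabilityMeasure_haar : IsProbabilityMeasure SU4.haar :=
  ⟨by
    have := Measure.haarMeasure_self (K₀ := (⊤ : TopologicalSpace.PositiveCompacts SU4))
    rwa [TopologicalSpace.PositiveCompacts.coe_top] at this⟩

instance gateMeasure.isMulLeftInvariant : (gateMeasure R).IsMulLeftInvariant :=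
  inferInstanceAs (Measure.pi _).IsMulLeftInvariant

instance gateMeasure.isProbabilityMeasure : IsProbabilityMeasure (gateMeasure R) :=
  inferInstanceAs (IsProbabilityMeasure (Measure.pi _))

theorem continuous_expShift_smul (H : Fin R → su4) :
    Continuous fun p : (Fin R → SU4) × ℝ => expShift (p.2 • H) p.1 := by
  refine continuous_pi fun v => Continuous.subtype_mk ?_ _
  refine Continuous.mul ?_ (continuous_subtype_val.comp ((continuous_apply v).comp continuous_fst))
  refine continuous_matrix fun a b => ?_
  exact ((Matrix.contDiff_exp_comp_apply (su4.mulIProj v) a b).continuous).comp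
    (continuous_snd.smul continuous_const)

theorem continuous_expShift (H : Fin R → su4) : Continuous (expShift H) := by
  rw [funext (expShift_eq_mul H)]
  exact continuous_const.mul continuous_id

theorem AnalyticOnNhd.ae_ne_zero {g : ℝ → ℂ} (hg : AnalyticOnNhd ℝ g Set.univ) {t : ℝ}
    (ht : g t ≠ 0) : ∀ᵐ s, g s ≠ 0 := by
  rcases hg.eqOn_zero_or_eventually_ne_zero_of_preconnected isPreconnected_univ with h | h
  · exact absurd (h (Set.mem_univ t)) ht
  · have := ae_restrict_le_codiscreteWithin (μ := (volume : Measure ℝ)) MeasurableSet.univ h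
    rwa [Measure.restrict_univ] at this

/-- Let `Z` be the set of zeros whose orbit contains a nonzero value. By analyticity every orbit
meets `Z` in a null set of times. Fubini then gives one time `t` whose translate of `Z` is null, and
invariance makes `Z` null. -/
theorem ae_orbit_eq_zero_of_eq_zero {f : (Fin R → SU4) → ℂ} (hf : f ∈ regularFunctions R)
    (H : Fin R → su4) :
    ∀ᵐ x ∂gateMeasure R, f x = 0 → ∀ t : ℝ, f (expShift (t • H) x) = 0 := by
  have hcf := continuous_of_mem_regularFunctions hf
  have hc := continuous_expShift_smul H
  let Z : Set (Fin R → SU4) := {x | f x = 0 ∧ ∃ t : ℝ, f (expShift (t • H) x) ≠ 0}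
  have hZ : MeasurableSet Z := by
    refine (isClosed_eq hcf continuous_const).measurableSet.inter (IsOpen.measurableSet ?_)
    have : {x | ∃ t : ℝ, f (expShift (t • H) x) ≠ 0} = ⋃ t : ℝ, {x | f (expShift (t • H) x) ≠ 0} := by
      ext x
      simp
    change IsOpen {x | ∃ t : ℝ, f (expShift (t • H) x) ≠ 0}
    rw [this]
    refine isOpen_iUnion fun t => ?_
    exact (isClosed_eq (hcf.comp (continuous_expShift (t • H))) continuous_const).isOpen_compl
  have h1 : ∀ᵐ x ∂gateMeasure R, ∀ᵐ t : ℝ, expShift (t • H) x ∉ Z := by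
    refine ae_of_all _ fun x => ?_
    by_cases hx : ∃ t : ℝ, f (expShift (t • H) x) ≠ 0
    · obtain ⟨t, ht⟩ := hx
      have han : AnalyticOnNhd ℝ (fun t : ℝ => f (expShift (t • H) x)) Set.univ :=
        ((contDiff_expShift hf x).comp (contDiff_id.smul contDiff_const)).analyticOnNhd
      filter_upwards [han.ae_ne_zero ht] with s hs hsZ
      exact hs hsZ.1
    · push Not at hx
      refine ae_of_all _ fun t ht => ?_
      obtain ⟨-, s, hs⟩ := ht
      rw [← expShift_add_smul] at hs
      exact hs (hx _)
  rw [Measure.ae_ae_comm (hc.measurable hZ).compl] at h1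
  obtain ⟨t, ht⟩ := h1.exists
  have h2 : gateMeasure R ((fun x => expShift (t • H) 1 * x) ⁻¹' Z) = 0 := by
    rw [← funext (expShift_eq_mul (t • H))]
    simpa [ae_iff] using! ht
  rw [measure_preimage_mul] at h2
  have h3 : ∀ᵐ x ∂gateMeasure R, x ∉ Z := by simpa [ae_iff] using h2
  filter_upwards [h3] with x hx hfx t
  by_contra h
  exact hx ⟨hfx, t, h⟩

/-- Countably many directions can be handled outside one null set. At a zero `x` outside it, `f`
vanishes at `expShift H x` for a dense set of `H`, so by continuity for all `H`, and these points
exhaust the group. -/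
theorem measure_zeroSet_eq_zero {f : (Fin R → SU4) → ℂ} (hf : f ∈ regularFunctions R)
    (hne : f ≠ 0) : gateMeasure R {x | f x = 0} = 0 := by
  obtain ⟨D, hD, hDd⟩ := TopologicalSpace.exists_countable_dense (Fin R → su4)
  have h1 : ∀ᵐ x ∂gateMeasure R, ∀ H ∈ D, f x = 0 → ∀ t : ℝ, f (expShift (t • H) x) = 0 :=
    (ae_ball_iff hD).mpr fun H _ => ae_orbit_eq_zero_of_eq_zero hf H
  have h2 : ∀ᵐ x ∂gateMeasure R, f x ≠ 0 := by
    filter_upwards [h1] with x hx hfx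
    refine hne (funext fun y => ?_)
    obtain ⟨H, rfl⟩ := exists_expShift_eq x y
    have := Continuous.ext_on hDd (contDiff_expShift hf x).continuous continuous_const
      (fun H hH => by simpa using hx H hH hfx 1)
    exact congrFun this H
  simpa [ae_iff] using h2

/-- Two null zero sets cannot cover a probability space. -/
instance regularFunctions.isDomain : IsDomain (regularFunctions R) := by
  have : NoZeroDivisors (regularFunctions R) := ⟨fun {f g} h => by
    by_contra! hfg
    have h1 := measure_zeroSet_eq_zero f.2 (fun h => hfg.1 (Subtype.ext h))
    have h2 := measure_zeroSet_eq_zero g.2 (fun h => hfg.2 (Subtype.ext h))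
    have h3 : {x | f.1 x = 0} ∪ {x | g.1 x = 0} = Set.univ := by
      ext x
      have := congrFun (congrArg Subtype.val h) x
      simpa using this
    have h4 := measure_union_null h1 h2
    rw [h3, measure_univ] at h4
    exact one_ne_zero h4⟩
  exact NoZeroDivisors.to_isDomain _

end ZeroSets

/-! ### The Jacobian criterion on the function field of the gate group. -/

section Jacobian

open scoped Matrix.Norms.Elementwise

/-- The ring homomorphism `x ↦ x + ε D x` into the dual numbers. -/
def Derivation.toDualNumber {k A : Type*} [CommRing k] [CommRing A] [Algebra k A]
    (D : Derivation k A A) : A →+* TrivSqZeroExt A A where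
  toFun x := TrivSqZeroExt.inl x + TrivSqZeroExt.inr (D x)
  map_one' := by ext <;> simp
  map_zero' := by ext <;> simp
  map_add' x y := by ext <;> simp
  map_mul' x y := by ext <;> simp [mul_comm]

/-- Jacobi's formula applied to `det U = 1`: over the dual numbers `det (1 + εN) = 1 + ε tr N`. -/
theorem Derivation.trace_map_mul_adjugate_eq_zero {k A m : Type*} [CommRing k] [CommRing A]
    [Algebra k A] [Fintype m] [DecidableEq m] (D : Derivation k A A) {U : Matrix m m A}
    (hU : U.det = 1) : (U.map D * U.adjugate).trace = 0 := by
  set N := U.map D * U.adjugate with hN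
  have hNU : N * U = U.map D := by rw [hN, mul_assoc, adjugate_mul, hU, one_smul, mul_one]
  let ι : A →+* TrivSqZeroExt A A := TrivSqZeroExt.inlHom A A
  let r : TrivSqZeroExt A A := TrivSqZeroExt.inr 1
  have hr : r ^ 2 = 0 := by
    rw [pow_two]
    exact TrivSqZeroExt.inr_mul_inr _ _ _
  have h1 : U.map D.toDualNumber = (1 + r • N.map ι) * U.map ι := by
    have h2 : N.map ι * U.map ι = (U.map D).map ι := by rw [← Matrix.map_mul, hNU]
    rw [add_mul, one_mul, Matrix.smul_mul, h2]
    ext a b <;> simp [Derivation.toDualNumber, ι, r]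
  have h3 := congrArg det h1
  rw [det_mul, ← RingHom.mapMatrix_apply, ← RingHom.mapMatrix_apply, ← RingHom.mapMatrix_apply,
    ← RingHom.map_det, ← RingHom.map_det, hU, map_one, map_one, mul_one,
    det_one_add_smul, hr, mul_zero, add_zero] at h3
  have h4 : (ι.mapMatrix N).trace = ι N.trace := by simp [trace, map_sum]
  rw [h4] at h3
  have h5 := congrArg TrivSqZeroExt.snd h3
  simpa [ι, r] using h5.symm

/-- The decomposition into Hermitian and skew-Hermitian parts, both traceless: `su(4)` spans `sl(4)`
over `ℂ`. -/
theorem su4.exists_eq_add_I_smul {M : Matrix (Fin 2 × Fin 2) (Fin 2 × Fin 2) ℂ} (hM : M.trace = 0) :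
    ∃ h₁ h₂ : su4, M = h₁.1 + Complex.I • h₂.1 := by
  have hM' : Mᴴ.trace = 0 := by rw [trace_conjTranspose, hM, star_zero]
  refine ⟨⟨(1 / 2 : ℂ) • (M + Mᴴ), ?_, ?_⟩, ⟨(-Complex.I / 2) • (M - Mᴴ), ?_, ?_⟩, ?_⟩
  · simp [IsHermitian, add_comm]
  · rw [trace_smul, trace_add, hM, hM', add_zero, smul_zero]
  · rw [IsHermitian, conjTranspose_smul, conjTranspose_sub, conjTranspose_conjTranspose]
    ext a b
    simp
    ring
  · rw [trace_smul, trace_sub, hM, hM', sub_zero, smul_zero]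
  · ext a b
    simp only [Matrix.add_apply, Matrix.smul_apply, Matrix.sub_apply, smul_eq_mul]
    linear_combination ((M a b - Mᴴ a b) / 2) * Complex.I_mul_I

theorem su4.exists_spanning_family : ∃ h : ((Fin 2 × Fin 2) × (Fin 2 × Fin 2)) × Fin 2 → su4,
    ∀ (K : Type) [Field K] [Algebra ℂ K] (N : Matrix (Fin 2 × Fin 2) (Fin 2 × Fin 2) K),
      N.trace = 0 → ∃ c : ((Fin 2 × Fin 2) × (Fin 2 × Fin 2)) × Fin 2 → K, ∀ a b,
        N a b = ∑ k, c k * algebraMap ℂ K (Complex.I * (h k).1 a b) := by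
  -- Matrix units with the diagonal ones made traceless. The correction terms in `∑ N p • E p` add
  -- up to the trace of `N`, so for traceless `N` this sum is `N`.
  let E : (Fin 2 × Fin 2) × (Fin 2 × Fin 2) → Matrix (Fin 2 × Fin 2) (Fin 2 × Fin 2) ℂ :=
    fun p => Matrix.single p.1 p.2 1 - if p.1 = p.2 then Matrix.single 0 0 1 else 0
  have hE : ∀ p, (E p).trace = 0 := by
    intro p
    by_cases h : p.1 = p.2
    · simp [E, h]
    · simp [E, h]
  choose h₁ h₂ hh using fun p => su4.exists_eq_add_I_smul (hE p)
  refine ⟨fun k => if k.2 = 0 then h₁ k.1 else h₂ k.1, fun K _ _ N hN => ?_⟩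
  -- From `E p = h₁ + i h₂ = (-i)(i h₁) + i h₂`.
  refine ⟨fun k => if k.2 = 0 then N k.1.1 k.1.2 * algebraMap ℂ K (-Complex.I) else N k.1.1 k.1.2,
    fun a b => ?_⟩
  have hEab : ∀ p, E p a b = (if p = (a, b) then 1 else 0) -
      if p.1 = p.2 then (if a = 0 ∧ b = 0 then 1 else 0) else 0 := by
    intro p
    refine (Matrix.sub_apply _ _ _ _).trans ?_
    congr 1
    · rw [single_apply]
      exact if_congr ⟨fun h => Prod.ext h.1 h.2, fun h => h ▸ ⟨rfl, rfl⟩⟩ rfl rfl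
    · by_cases h : p.1 = p.2
      · rw [if_pos h, if_pos h, single_apply]
        exact if_congr (by rw [eq_comm, eq_comm (a := b)]) rfl rfl
      · rw [if_neg h, if_neg h]
        rfl
  have h1 : N a b = ∑ p : (Fin 2 × Fin 2) × (Fin 2 × Fin 2), N p.1 p.2 * algebraMap ℂ K (E p a b) := by
    have h2 : ∀ p : (Fin 2 × Fin 2) × (Fin 2 × Fin 2), N p.1 p.2 * algebraMap ℂ K (E p a b) =
        (if p = (a, b) then N p.1 p.2 else 0) -
        (if p.1 = p.2 then N p.1 p.2 else 0) * (if a = 0 ∧ b = 0 then 1 else 0) := by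
      intro p
      rw [hEab, map_sub, mul_sub]
      congr 1
      · split_ifs <;> simp
      · by_cases h : p.1 = p.2 <;> by_cases h0 : a = 0 ∧ b = 0 <;> simp [h, h0]
    have h3 : ∑ p : (Fin 2 × Fin 2) × (Fin 2 × Fin 2), (if p.1 = p.2 then N p.1 p.2 else 0) =
        N.trace := by
      rw [Fintype.sum_prod_type, trace]
      refine Finset.sum_congr rfl fun x _ => ?_
      exact (Finset.sum_ite_eq _ _ _).trans (if_pos (Finset.mem_univ _))
    simp only [h2]
    rw [Finset.sum_sub_distrib, ← Finset.sum_mul, h3, hN, zero_mul, sub_zero]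
    exact ((Finset.sum_ite_eq' Finset.univ (a, b) fun x => N x.1 x.2).trans
      (if_pos (Finset.mem_univ _))).symm
  rw [h1]
  refine Eq.trans ?_ (Fintype.sum_prod_type _).symm
  refine Finset.sum_congr rfl fun p _ => ?_
  rw [Fin.sum_univ_two, hh p]
  simp only [Matrix.add_apply, Matrix.smul_apply, smul_eq_mul, if_true, one_ne_zero, if_false]
  rw [mul_assoc, ← map_mul, ← mul_add, ← map_add]
  congr 2
  linear_combination ((h₁ p).1 a b) * Complex.I_mul_I

theorem finiteType_regularFunctions (R : ℕ) : Algebra.FiniteType ℂ (regularFunctions R) :=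
  (regularFunctions R).fg_iff_finiteType.mp
    (Subalgebra.fg_def.mpr ⟨_, Set.finite_range _, rfl⟩)

/-- The matrix of the entries of the `v`-th gate, over the ring of regular functions. -/
noncomputable def genericGate {R : ℕ} (v : Fin R) :
    Matrix (Fin 2 × Fin 2) (Fin 2 × Fin 2) (regularFunctions R) :=
  Matrix.of fun a b => ⟨gateEntry v a b, gateEntry_mem v a b⟩

theorem det_genericGate {R : ℕ} (v : Fin R) : (genericGate v).det = 1 := by
  refine Subtype.ext (funext fun x => ?_)
  let ev : regularFunctions R →+* ℂ :=
    (Pi.evalRingHom (fun _ : Fin R → SU4 => ℂ) x).comp (regularFunctions R).val.toRingHom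
  change ev (genericGate v).det = 1
  rw [RingHom.map_det]
  exact (mem_specialUnitaryGroup_iff.mp (x v).2).2

theorem adjoin_genericGate (R : ℕ) :
    Algebra.adjoin ℂ (Set.range fun p : Fin R × (Fin 2 × Fin 2) × (Fin 2 × Fin 2) =>
      genericGate p.1 p.2.1 p.2.2) = ⊤ := by
  have h : ∀ f : (Fin R → SU4) → ℂ, (hf : f ∈ regularFunctions R) →
      (⟨f, hf⟩ : regularFunctions R) ∈ Algebra.adjoin ℂ
        (Set.range fun p : Fin R × (Fin 2 × Fin 2) × (Fin 2 × Fin 2) =>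
          genericGate p.1 p.2.1 p.2.2) := by
    intro f hf
    induction hf using regularFunctions_induction with
    | entry v a b => exact Algebra.subset_adjoin ⟨(v, a, b), rfl⟩
    | const c => exact Subalgebra.algebraMap_mem _ c
    | add f g _ _ hf hg => exact add_mem hf hg
    | mul f g _ _ hf hg => exact mul_mem hf hg
  exact eq_top_iff.mpr fun f _ => h f.1 f.2

theorem lieDerivation_genericGate {R : ℕ} (H : Fin R → su4) (v : Fin R) (a b : Fin 2 × Fin 2) :
    lieDerivation H (genericGate v a b) =
      ∑ c, algebraMap ℂ (regularFunctions R) (Complex.I * (H v).1 a c) * genericGate v c b := by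
  refine Subtype.ext ?_
  refine (lieDeriv_gateEntry H v a b).trans ?_
  ext x
  simp [Finset.sum_apply, genericGate]

/-- Every derivation of the function field of `SU(4)^R` is a combination of derivatives in
directions tangent to `SU(4)^R`. -/
theorem exists_lieDerivation_spanning_family (R : ℕ) (K : Type) [Field K] [Algebra ℂ K]
    [Algebra (regularFunctions R) K] [IsScalarTower ℂ (regularFunctions R) K] :
    ∃ H : Fin R × ((Fin 2 × Fin 2) × (Fin 2 × Fin 2)) × Fin 2 → Fin R → su4,
      ∀ D : Derivation ℂ K K, ∃ c : _ → K, ∀ f : regularFunctions R,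
        D (algebraMap _ K f) = ∑ k, c k * algebraMap _ K (lieDerivation (H k) f) := by
  obtain ⟨h, hh⟩ := su4.exists_spanning_family
  refine ⟨fun k => Pi.single k.1 (h k.2), fun D => ?_⟩
  let U : Fin R → Matrix (Fin 2 × Fin 2) (Fin 2 × Fin 2) K :=
    fun v => (genericGate v).map (algebraMap (regularFunctions R) K)
  have hU : ∀ v, (U v).det = 1 := fun v => by
    have := (algebraMap (regularFunctions R) K).map_det (genericGate v)
    rw [det_genericGate, map_one] at this
    exact this.symm
  -- The logarithmic derivative `D(U) U⁻¹` is traceless, so it is a combination of the matrices `i h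
  -- k` over `K`; its coefficients are those of `D`.
  choose c hc using fun v => hh K ((U v).map D * (U v).adjugate)
    (D.trace_map_mul_adjugate_eq_zero (hU v))
  refine ⟨fun k => c k.1 k.2, ?_⟩
  let D₁ : Derivation ℂ (regularFunctions R) K := D.compAlgebraMap _
  let D₂ : Derivation ℂ (regularFunctions R) K :=
    ∑ k : Fin R × ((Fin 2 × Fin 2) × (Fin 2 × Fin 2)) × Fin 2, c k.1 k.2 •
      (Algebra.linearMap (regularFunctions R) K).compDer (lieDerivation (Pi.single k.1 (h k.2)))
  have hD₂ : ∀ f, D₂ f = ∑ k : Fin R × ((Fin 2 × Fin 2) × (Fin 2 × Fin 2)) × Fin 2, c k.1 k.2 *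
      algebraMap _ K (lieDerivation (Pi.single k.1 (h k.2)) f) := by
    intro f
    change Derivation.coeFnAddMonoidHom D₂ f = _
    rw [map_sum, Finset.sum_apply]
    rfl
  -- Derivations are determined on the gate entries. There the combination gives `(D(U) U⁻¹) U`, and
  -- directions at other gates contribute nothing.
  have key : D₁ = D₂ := by
    refine Derivation.ext_of_adjoin_eq_top _ (adjoin_genericGate R) ?_
    rintro _ ⟨⟨v, a, b⟩, rfl⟩
    rw [hD₂]
    have h1 : D₁ (genericGate v a b) = ((U v).map D * (U v).adjugate * U v) a b := by
      rw [mul_assoc, adjugate_mul, hU, one_smul, mul_one]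
      rfl
    refine h1.trans ?_
    rw [mul_apply]
    refine Eq.trans ?_ (Fintype.sum_prod_type _).symm
    rw [Finset.sum_eq_single v]
    · simp only [hc, lieDerivation_genericGate, map_sum, map_mul (algebraMap (regularFunctions R) K),
        ← IsScalarTower.algebraMap_apply, Pi.single_eq_same, Finset.mul_sum, Finset.sum_mul]
      rw [Finset.sum_comm]
      refine Finset.sum_congr rfl fun k _ => Finset.sum_congr rfl fun e _ => ?_
      rw [mul_assoc]
      rfl
    · intro w _ hw
      refine Finset.sum_eq_zero fun k _ => ?_
      simp only [lieDerivation_genericGate, Pi.single_eq_of_ne hw.symm]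
      simp
    · simp
  intro f
  rw [← hD₂, ← key]
  rfl

/-- Derivations of `K` dual to the `f i` are combinations of Lie derivatives, so the Jacobian `J` of
the `f i` has a right inverse over `K`. Some maximal minor of `J` is thus a nonzero regular
function. -/
theorem AlgebraicIndependent.exists_det_lieDeriv_ne_zero {R d : ℕ} {f : Fin d → regularFunctions R}
    (hf : AlgebraicIndependent ℂ f) : ∃ (H : Fin d → Fin R → su4) (x : Fin R → SU4),
      (Matrix.of fun i j => lieDeriv (H j) (f i) x).det ≠ 0 := by
  let K := FractionRing (regularFunctions R)
  have : Algebra.FiniteType ℂ (regularFunctions R) := finiteType_regularFunctions R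
  have : Algebra.EssFiniteType (regularFunctions R) K := .of_isLocalization _ (nonZeroDivisors _)
  have : Algebra.EssFiniteType ℂ K := .comp ℂ (regularFunctions R) K
  have hinj : Function.Injective (algebraMap (regularFunctions R) K) := IsFractionRing.injective _ _
  have hf' : AlgebraicIndependent ℂ (algebraMap (regularFunctions R) K ∘ f) :=
    hf.map' (f := IsScalarTower.toAlgHom ℂ (regularFunctions R) K) hinj
  choose D hD using fun j : Fin d => hf'.exists_derivation (Pi.single j 1)
  obtain ⟨H, hH⟩ := exists_lieDerivation_spanning_family R K
  choose c hc using fun j => hH (D j)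
  let J : Matrix (Fin d) _ (regularFunctions R) := Matrix.of fun i k => lieDerivation (H k) (f i)
  have hJC : (J.map (algebraMap _ K) * Matrix.of fun k j => c j k) = 1 := by
    ext i j
    have h1 := hc j (f i)
    rw [show D j (algebraMap _ K (f i)) = (1 : Matrix (Fin d) (Fin d) K) i j from
      (hD j i).trans (by rw [one_apply, Pi.single_apply])] at h1
    rw [h1, mul_apply]
    exact Finset.sum_congr rfl fun k _ => mul_comm _ _
  obtain ⟨σ, hσ⟩ := exists_det_submatrix_ne_zero (J := J.map (algebraMap _ K))
    (C := Matrix.of fun k j => c j k) (by rw [hJC, det_one]; exact one_ne_zero)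
  have h2 : (J.submatrix id σ).det ≠ 0 := by
    intro h
    refine hσ ?_
    have := (algebraMap (regularFunctions R) K).map_det (J.submatrix id σ)
    rw [h, map_zero] at this
    exact this.symm
  obtain ⟨x, hx⟩ : ∃ x, (J.submatrix id σ).det.1 x ≠ 0 := by
    by_contra! h
    exact h2 (Subtype.ext (funext h))
  refine ⟨fun j => H (σ j), x, ?_⟩
  let ev : regularFunctions R →+* ℂ :=
    (Pi.evalRingHom (fun _ : Fin R → SU4 => ℂ) x).comp (regularFunctions R).val.toRingHom
  have h3 : ev (J.submatrix id σ).det ≠ 0 := hx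
  rw [RingHom.map_det] at h3
  exact h3

end Jacobian

/-! ### Real polynomial equations for the gate group. -/

section RealPolynomials

theorem MvPolynomial.exists_re_im {ι : Type*} (P : MvPolynomial ι ℂ) :
    ∃ p q : MvPolynomial ι ℝ, ∀ y : ι → ℝ,
      MvPolynomial.eval y p = (MvPolynomial.eval (fun i => (y i : ℂ)) P).re ∧
      MvPolynomial.eval y q = (MvPolynomial.eval (fun i => (y i : ℂ)) P).im := by
  induction P using MvPolynomial.induction_on with
  | C c => exact ⟨.C c.re, .C c.im, fun y => by simp⟩
  | add f g hf hg =>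
    obtain ⟨p, q, h⟩ := hf
    obtain ⟨p', q', h'⟩ := hg
    exact ⟨p + p', q + q', fun y => by simp [h, h']⟩
  | mul_X f i hf =>
    obtain ⟨p, q, h⟩ := hf
    exact ⟨p * .X i, q * .X i, fun y => by simp [h]⟩

/-- It suffices that `V` is Zariski closed, so no finite list of equations has to be exhibited. -/
theorem isAlgebraicSet_of_forall {ι : Type*} [Finite ι] {V : Set (ι → ℝ)}
    (h : ∀ y, (∀ p : MvPolynomial ι ℝ, (∀ z ∈ V, MvPolynomial.eval z p = 0) →
      MvPolynomial.eval y p = 0) → y ∈ V) : IsAlgebraicSet V := by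
  have : V = {y | ∀ p ∈ {p : MvPolynomial ι ℝ | ∀ z ∈ V, MvPolynomial.eval z p = 0},
      MvPolynomial.eval y p = 0} :=
    Set.Subset.antisymm (fun y hy p hp => hp y hy) fun y hy => h y hy
  rw [this]
  exact isAlgebraicSet_of_set _

/-- A point at which all polynomials vanishing on `SU(4)^R` vanish is a point of `SU(4)^R`. -/
theorem exists_realEntries_eq {R : ℕ}
    {y : (Fin R × (Fin 2 × Fin 2) × (Fin 2 × Fin 2)) ⊕ (Fin R × (Fin 2 × Fin 2) × (Fin 2 × Fin 2)) → ℝ}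
    (hy : ∀ p, (∀ x : Fin R → SU4, MvPolynomial.eval (realEntries x) p = 0) →
      MvPolynomial.eval y p = 0) : ∃ x, realEntries x = y := by
  have hyC : ∀ P : MvPolynomial _ ℂ,
      (∀ x : Fin R → SU4, MvPolynomial.eval (fun i => (realEntries x i : ℂ)) P = 0) →
      MvPolynomial.eval (fun i => (y i : ℂ)) P = 0 := by
    intro P hP
    obtain ⟨p, q, h⟩ := P.exists_re_im
    refine Complex.ext ?_ ?_
    · rw [← (h y).1]
      exact hy p fun x => by rw [(h _).1, hP, Complex.zero_re]
    · rw [← (h y).2]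
      exact hy q fun x => by rw [(h _).2, hP, Complex.zero_im]
  let G : Fin R → Matrix (Fin 2 × Fin 2) (Fin 2 × Fin 2) (MvPolynomial
      ((Fin R × (Fin 2 × Fin 2) × (Fin 2 × Fin 2)) ⊕ (Fin R × (Fin 2 × Fin 2) × (Fin 2 × Fin 2))) ℂ) :=
    fun v => Matrix.of fun a b => .X (Sum.inl (v, a, b)) + .C Complex.I * .X (Sum.inr (v, a, b))
  -- `G'` is the formal adjoint of `G`: at real points the two evaluate to adjoint matrices, so
  -- unitarity becomes the polynomial equation `G v * G' v = 1`.
  let G' : Fin R → Matrix (Fin 2 × Fin 2) (Fin 2 × Fin 2) (MvPolynomial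
      ((Fin R × (Fin 2 × Fin 2) × (Fin 2 × Fin 2)) ⊕ (Fin R × (Fin 2 × Fin 2) × (Fin 2 × Fin 2))) ℂ) :=
    fun v => Matrix.of fun a b => .X (Sum.inl (v, b, a)) - .C Complex.I * .X (Sum.inr (v, b, a))
  let ev := fun w : (Fin R × (Fin 2 × Fin 2) × (Fin 2 × Fin 2)) ⊕
      (Fin R × (Fin 2 × Fin 2) × (Fin 2 × Fin 2)) → ℝ =>
    (MvPolynomial.eval (fun i => (w i : ℂ)))
  have hG' : ∀ w v, (ev w).mapMatrix (G' v) = star ((ev w).mapMatrix (G v)) := by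
    intro w v
    ext a b
    simp [ev, G, G', sub_eq_add_neg]
  have hx : ∀ (x : Fin R → SU4) v, (ev (realEntries x)).mapMatrix (G v) = x v := by
    intro x v
    ext a b
    simp only [ev, G, realEntries, RingHom.mapMatrix_apply, map_apply, of_apply, map_add, map_mul,
      MvPolynomial.eval_X, MvPolynomial.eval_C, Sum.elim_inl, Sum.elim_inr]
    rw [mul_comm]
    exact Complex.re_add_im _
  have hmem : ∀ v, (ev y).mapMatrix (G v) ∈ specialUnitaryGroup (Fin 2 × Fin 2) ℂ := by
    intro v
    rw [mem_specialUnitaryGroup_iff, mem_unitaryGroup_iff]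
    constructor
    · rw [← hG', ← map_mul, ← sub_eq_zero, ← map_one ((ev y).mapMatrix), ← map_sub]
      ext a b
      refine hyC ((G v * G' v - 1) a b) fun x => ?_
      have : (ev (realEntries x)).mapMatrix (G v * G' v - 1) = 0 := by
        rw [map_sub, map_mul, hG', hx, map_one, mem_unitaryGroup_iff.mp (x v).2.1, sub_self]
      exact congrFun (congrFun this a) b
    · rw [← RingHom.map_det, ← sub_eq_zero, ← map_one (ev y), ← map_sub]
      refine hyC ((G v).det - 1) fun x => ?_
      change ev (realEntries x) _ = 0
      rw [map_sub, RingHom.map_det, hx, map_one,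
        (mem_specialUnitaryGroup_iff.mp (x v).2).2, sub_self]
  refine ⟨fun v => ⟨_, hmem v⟩, ?_⟩
  funext i
  rcases i with ⟨v, a, b⟩ | ⟨v, a, b⟩ <;> simp [realEntries, ev, G]

theorem MvPolynomial.eq_zero_of_eval_ofReal_eq_zero {d : ℕ} {P : MvPolynomial (Fin d) ℂ}
    {s : Set (Fin d → ℝ)} {y : Fin d → ℝ} (hs : s ∈ nhds y)
    (h : ∀ w ∈ s, MvPolynomial.eval (fun i => (w i : ℂ)) P = 0) : P = 0 := by
  obtain ⟨ε, hε, hball⟩ := Metric.mem_nhds_iff.mp hs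
  -- A neighbourhood in the sup metric contains a product of intervals, and a polynomial vanishing
  -- on a product of infinite sets is zero.
  refine MvPolynomial.funext_set (fun i => Complex.ofReal '' Metric.ball (y i) ε) ?_ ?_
  · intro i
    refine Set.Infinite.image Complex.ofReal_injective.injOn ?_
    rw [Real.ball_eq_Ioo]
    exact Set.Ioo_infinite (by linarith)
  · intro z hz
    choose w hw hwz using fun i => hz i (Set.mem_univ i)
    obtain rfl : (fun i => (w i : ℂ)) = z := _root_.funext hwz
    rw [map_zero]
    refine h w (hball ?_)
    rw [Metric.mem_ball, dist_pi_lt_iff hε]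
    exact fun i => hw i

end RealPolynomials

/-! ### Rank loci and accessible dimension of the contraction map. -/

namespace Architecture

open scoped Matrix.Norms.Elementwise

variable {n R : ℕ} (A : Architecture n R)

theorem contractionMap_apply_mem (y z : Fin n → Fin 2) :
    (fun x => (A.contractionMap x : QubitMatrix n) y z) ∈ regularFunctions R := by
  have : (fun x => (A.contractionMap x : QubitMatrix n) y z) =
      ∑ ℓ : Fin n ⊕ Fin R × Fin 2 → Fin 2,
        if (∀ i, ℓ (Sum.inl i) = z i) ∧ (∀ i, ℓ (A.wiring.symm (Sum.inl i)) = y i) then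
          ∏ v, gateEntry v (ℓ (Sum.inr (v, 0)), ℓ (Sum.inr (v, 1)))
            (ℓ (A.wiring.symm (Sum.inr (v, 0))), ℓ (A.wiring.symm (Sum.inr (v, 1))))
        else 0 := by
    ext x
    rw [Finset.sum_apply]
    refine Finset.sum_congr rfl fun ℓ _ => ?_
    split_ifs
    · rw [Finset.prod_apply]
      rfl
    · rfl
  rw [this]
  refine sum_mem fun ℓ _ => ?_
  split_ifs
  · exact prod_mem fun v _ => gateEntry_mem _ _ _
  · exact zero_mem _

/-- A real linear coordinate of the contraction map. -/
noncomputable def coordinate (ℓ : QubitMatrix n →ₗ[ℝ] ℝ) : (Fin R → SU4) → ℂ :=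
  fun x => (ℓ (A.contractionMap x : QubitMatrix n) : ℂ)

theorem ofReal_re_mem {f : (Fin R → SU4) → ℂ} (hf : f ∈ regularFunctions R) :
    (fun x => ((f x).re : ℂ)) ∈ regularFunctions R := by
  have : (fun x => ((f x).re : ℂ)) = (fun _ => (1 / 2 : ℂ)) * (f + star f) := by
    ext x
    have := Complex.add_conj (f x)
    simp only [Pi.mul_apply, Pi.add_apply, Pi.star_apply, Complex.star_def, this]
    push_cast
    ring
  rw [this]
  exact mul_mem (const_mem_regularFunctions _) (add_mem hf (star_mem_regularFunctions hf))

theorem coordinate_mem (ℓ : QubitMatrix n →ₗ[ℝ] ℝ) : A.coordinate ℓ ∈ regularFunctions R := by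
  -- The imaginary part is written as `re (-i z)`, so that `ofReal_re_mem` covers both terms.
  have h : ∀ M : QubitMatrix n, ℓ M = ∑ y, ∑ z, ((M y z).re * ℓ (Matrix.single y z 1) +
      (-Complex.I * M y z).re * ℓ (Matrix.single y z Complex.I)) := by
    intro M
    conv_lhs => rw [matrix_eq_sum_single M]
    rw [map_sum]
    refine Finset.sum_congr rfl fun y _ => ?_
    rw [map_sum]
    refine Finset.sum_congr rfl fun z _ => ?_
    have : Matrix.single y z (M y z) = (M y z).re • Matrix.single y z (1 : ℂ) +
        (-Complex.I * M y z).re • Matrix.single y z Complex.I := by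
      rw [smul_single, smul_single, ← single_add]
      congr 1
      refine Complex.ext ?_ ?_ <;> simp
    rw [this, map_add, map_smul, map_smul, smul_eq_mul, smul_eq_mul]
  have h2 : A.coordinate ℓ = ∑ y, ∑ z,
      ((fun x => (((A.contractionMap x : QubitMatrix n) y z).re : ℂ)) *
        (fun _ => ((ℓ (Matrix.single y z 1) : ℝ) : ℂ)) +
      (fun x => ((((fun _ => -Complex.I) * fun x => (A.contractionMap x : QubitMatrix n) y z :
        (Fin R → SU4) → ℂ) x).re : ℂ)) * (fun _ => ((ℓ (Matrix.single y z Complex.I) : ℝ) : ℂ))) := by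
    ext x
    rw [coordinate, h]
    simp [Finset.sum_apply]
  rw [h2]
  refine sum_mem fun y _ => sum_mem fun z _ => ?_
  have hm := A.contractionMap_apply_mem y z
  exact add_mem (mul_mem (ofReal_re_mem hm) (const_mem_regularFunctions _))
    (mul_mem (ofReal_re_mem (mul_mem (const_mem_regularFunctions _) hm))
      (const_mem_regularFunctions _))

theorem contDiff_contractionMap_expShift (x : Fin R → SU4) :
    ContDiff ℝ ω (fun H => (A.contractionMap (expShift H x) : QubitMatrix n)) :=
  contDiff_pi.mpr fun y => contDiff_pi.mpr fun z =>
    contDiff_expShift (A.contractionMap_apply_mem y z) x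

/-- The derivative of the contraction map at `x`. -/
noncomputable def tangentMap (x : Fin R → SU4) : (Fin R → su4) →L[ℝ] QubitMatrix n :=
  fderiv ℝ (fun H => (A.contractionMap (expShift H x) : QubitMatrix n)) 0

theorem rank_eq (x : Fin R → SU4) : A.rank x = Module.finrank ℝ (A.tangentMap x).toLinearMap.range :=
  rfl

theorem lieDeriv_coordinate (ℓ : QubitMatrix n →ₗ[ℝ] ℝ) (H : Fin R → su4) (x : Fin R → SU4) :
    lieDeriv H (A.coordinate ℓ) x = (ℓ (A.tangentMap x H) : ℂ) := by
  have h1 : HasFDerivAt (fun H => (A.contractionMap (expShift H x) : QubitMatrix n))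
      (A.tangentMap x) 0 :=
    ((A.contDiff_contractionMap_expShift x).differentiable (by simp) 0).hasFDerivAt
  let L : QubitMatrix n →L[ℝ] ℂ := Complex.ofRealCLM.comp ℓ.toContinuousLinearMap
  have h2 := L.hasFDerivAt.comp 0 h1
  exact DFunLike.congr_fun h2.fderiv H

/-- The minor of the derivative of the contraction map in given coordinates and directions. -/
noncomputable def minor {r : ℕ} (ℓ : Fin r → QubitMatrix n →ₗ[ℝ] ℝ) (H : Fin r → Fin R → su4) :
    (Fin R → SU4) → ℂ :=
  fun x => (Matrix.of fun i j => lieDeriv (H j) (A.coordinate (ℓ i)) x).det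

theorem minor_mem {r : ℕ} (ℓ : Fin r → QubitMatrix n →ₗ[ℝ] ℝ) (H : Fin r → Fin R → su4) :
    A.minor ℓ H ∈ regularFunctions R :=
  det_mem_regularFunctions fun _ _ => lieDeriv_mem _ (A.coordinate_mem _)

theorem le_rank_iff {r : ℕ} {x : Fin R → SU4} : r ≤ A.rank x ↔
    ∃ (ℓ : Fin r → QubitMatrix n →ₗ[ℝ] ℝ) (H : Fin r → Fin R → su4), A.minor ℓ H x ≠ 0 := by
  rw [rank_eq, LinearMap.le_finrank_range_iff]
  refine exists_congr fun ℓ => exists_congr fun H => not_congr ?_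
  have : A.minor ℓ H x =
      (((Matrix.of fun i j => ℓ i ((A.tangentMap x).toLinearMap (H j))).det : ℝ) : ℂ) := by
    refine Eq.trans ?_ (Complex.ofRealHom.map_det _).symm
    refine congrArg det ?_
    ext i j
    exact A.lieDeriv_coordinate _ _ _
  rw [this, Complex.ofReal_eq_zero]

/-- `sSup` of an unbounded set of naturals is `0`; boundedness makes `maxRank` an attained maximum.
-/
theorem bddAbove_range_rank : BddAbove (Set.range A.rank) := by
  refine ⟨Module.finrank ℝ (QubitMatrix n), ?_⟩
  rintro _ ⟨x, rfl⟩
  exact Submodule.finrank_le _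

theorem rank_le_maxRank (x : Fin R → SU4) : A.rank x ≤ A.maxRank :=
  le_csSup A.bddAbove_range_rank ⟨x, rfl⟩

theorem exists_rank_eq_maxRank : ∃ x, A.rank x = A.maxRank :=
  Nat.sSup_mem (Set.range_nonempty _) A.bddAbove_range_rank

theorem mem_lowRankLocus {r : ℕ} {x : Fin R → SU4} : x ∈ A.lowRankLocus r ↔ A.rank x < r := by
  simp [lowRankLocus, rankLocus]

theorem lowRankLocus_eq_iInter (r : ℕ) : A.lowRankLocus r =
    ⋂ (ℓ : Fin r → QubitMatrix n →ₗ[ℝ] ℝ) (H : Fin r → Fin R → su4), {x | A.minor ℓ H x = 0} := by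
  ext x
  rw [mem_lowRankLocus, ← not_le, le_rank_iff]
  simp

theorem rankLocus_maxRank : A.rankLocus A.maxRank = (A.lowRankLocus A.maxRank)ᶜ := by
  ext x
  rw [Set.mem_compl_iff, mem_lowRankLocus, not_lt]
  exact ⟨fun h => h.ge, fun h => le_antisymm (A.rank_le_maxRank x) h⟩

theorem isClosed_lowRankLocus (r : ℕ) : IsClosed (A.lowRankLocus r) := by
  rw [lowRankLocus_eq_iInter]
  exact isClosed_iInter fun ℓ => isClosed_iInter fun H =>
    isClosed_eq (continuous_of_mem_regularFunctions (A.minor_mem ℓ H)) continuous_const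

/-- A point of the Zariski closure lies in `SU(4)^R`, since the equations of the group hold there,
and the real and imaginary parts of every minor vanish at it. -/
theorem isAlgebraicSet_lowRankLocus (r : ℕ) : IsAlgebraicSet (realEntries '' A.lowRankLocus r) := by
  refine isAlgebraicSet_of_forall fun y hy => ?_
  obtain ⟨x, rfl⟩ := exists_realEntries_eq fun p hp => hy p (by rintro _ ⟨x, -, rfl⟩; exact hp x)
  refine ⟨x, ?_, rfl⟩
  rw [lowRankLocus_eq_iInter]
  refine Set.mem_iInter₂.mpr fun ℓ H => ?_
  obtain ⟨p, q, h⟩ := exists_mvPolynomial_of_mem_regularFunctions (A.minor_mem ℓ H)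
  have h0 : ∀ z ∈ A.lowRankLocus r, A.minor ℓ H z = 0 := fun z hz => by
    rw [lowRankLocus_eq_iInter] at hz
    exact Set.mem_iInter₂.mp hz ℓ H
  refine Complex.ext ?_ ?_
  · rw [← (h x).1]
    refine hy p ?_
    rintro _ ⟨z, hz, rfl⟩
    rw [(h z).1, h0 z hz, Complex.zero_re]
  · rw [← (h x).2]
    refine hy q ?_
    rintro _ ⟨z, hz, rfl⟩
    rw [(h z).2, h0 z hz, Complex.zero_im]

theorem measure_lowRankLocus_maxRank : gateMeasure R (A.lowRankLocus A.maxRank) = 0 := by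
  obtain ⟨x, hx⟩ := A.exists_rank_eq_maxRank
  obtain ⟨ℓ, H, hne⟩ := A.le_rank_iff.mp hx.ge
  refine MeasureTheory.measure_mono_null ?_
    (measure_zeroSet_eq_zero (A.minor_mem ℓ H) fun h => hne (congrFun h x))
  rw [lowRankLocus_eq_iInter]
  exact fun z hz => Set.mem_iInter₂.mp hz ℓ H

/-- The dichotomy is algebraic: if the `d` coordinates are independent, the Jacobian criterion gives
a point of rank at least `d`; a relation between them would vanish on an open subset of `ℝ^d`. -/
theorem le_maxRank_of_isSmoothSubmanifold {d : ℕ} {M : Set (QubitMatrix n)}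
    (hM : M ⊆ A.implementable) (hne : M.Nonempty) (hd : IsSmoothSubmanifold d M) :
    d ≤ A.maxRank := by
  obtain ⟨ℓ, y, hy⟩ := hd.exists_image_mem_nhds hne
  by_cases hind : AlgebraicIndependent ℂ
      fun i => (⟨A.coordinate (ℓ i), A.coordinate_mem (ℓ i)⟩ : regularFunctions R)
  · obtain ⟨H, x, hx⟩ := hind.exists_det_lieDeriv_ne_zero
    exact (A.le_rank_iff.mpr ⟨ℓ, H, hx⟩).trans (A.rank_le_maxRank x)
  · rw [algebraicIndependent_iff] at hind
    push Not at hind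
    obtain ⟨P, hP, hP0⟩ := hind
    refine absurd (MvPolynomial.eq_zero_of_eval_ofReal_eq_zero hy ?_) hP0
    rintro _ ⟨q, hq, rfl⟩
    -- Since `q` is the image of some `x`, evaluating the relation at `x` shows that `P` vanishes at
    -- the coordinates of `q`.
    obtain ⟨x, rfl⟩ := hM hq
    let ev : regularFunctions R →ₐ[ℂ] ℂ :=
      (Pi.evalAlgHom ℂ (fun _ : Fin R → SU4 => ℂ) x).comp (regularFunctions R).val
    have h := congrArg ev hP
    rw [map_zero, ← AlgHom.comp_apply, MvPolynomial.comp_aeval] at h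
    rw [← MvPolynomial.coe_aeval_eq_eval]
    exact h

theorem accessibleDim_eq_maxRank : A.accessibleDim = A.maxRank := by
  have hub : ∀ d ∈ {d | ∃ M ⊆ A.implementable, M.Nonempty ∧ IsSmoothSubmanifold d M},
      d ≤ A.maxRank := by
    rintro d ⟨M, hM, hne, hd⟩
    exact A.le_maxRank_of_isSmoothSubmanifold hM hne hd
  have hmem : A.maxRank ∈ {d | ∃ M ⊆ A.implementable, M.Nonempty ∧ IsSmoothSubmanifold d M} := by
    obtain ⟨x, hx⟩ := A.exists_rank_eq_maxRank
    obtain ⟨M, hM, hne, hd⟩ := exists_isSmoothSubmanifold_subset_range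
      ((A.contDiff_contractionMap_expShift x).of_le le_top)
    refine ⟨M, hM.trans ?_, hne, ?_⟩
    · rintro _ ⟨H, rfl⟩
      exact ⟨expShift H x, rfl⟩
    · rw [← hx]
      exact hd
  exact le_antisymm (csSup_le ⟨_, hmem⟩ hub) (le_csSup ⟨_, hub⟩ hmem)

end Architecture

theorem lemma1 {n R : ℕ} (A : Architecture n R) :
    IsAlgebraicSet (realEntries '' A.lowRankLocus A.maxRank) ∧
    A.lowRankLocus A.maxRank ≠ Set.univ ∧
    gateMeasure R (A.lowRankLocus A.maxRank) = 0 ∧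
    IsClosed (A.lowRankLocus A.maxRank) ∧
    IsOpen (A.rankLocus A.maxRank) ∧
    gateMeasure R (A.rankLocus A.maxRank) = 1 ∧
    A.accessibleDim = A.maxRank := by
  have hc := A.isClosed_lowRankLocus A.maxRank
  refine ⟨A.isAlgebraicSet_lowRankLocus _, ?_, A.measure_lowRankLocus_maxRank, hc, ?_, ?_,
    A.accessibleDim_eq_maxRank⟩
  · obtain ⟨x, hx⟩ := A.exists_rank_eq_maxRank
    intro h
    exact (A.mem_lowRankLocus.mp (h ▸ Set.mem_univ x)).ne hx
  · rw [A.rankLocus_maxRank]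
    exact hc.isOpen_compl
  · rw [A.rankLocus_maxRank, MeasureTheory.prob_compl_eq_one_iff hc.measurableSet]
    exact A.measure_lowRankLocus_maxRank
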